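/- For $n\ge 1$ and $a=(a_1,\ldots,a_n)\in(0,\infty)^n$ let $Z_n(s;a)$ be the Epstein zeta function, i.e. the meromorphic continuation to $\mathbb{C}$ (holomorphic except for a pole at $s=n/2$) of $$\sum_{k\in\mathbb{Z}^n\setminus\{0\}}\Big(\sum_{i=1}^n (a_ik_i)^2\Big)^{-s},\qquad \operatorname{Re} s>\tfrac n2,$$ and put $$\Xi_n(s;a)=\sqrt{\textstyle\prod_{i=1}^n a_i}\;\pi^{-s}\,\Gamma(s)\,Z_n(s;a),\qquad \Xi_n(s)=\Xi_n(s;1,\ldots,1).$$ Let $I_{n,+}=\{s\in(0,n/2):\Xi_n(s)>0\}$ and $I_{n,-}=\{s\in(0,n/2):\Xi_n(s)<0\}$. For real $s\in(0,n/2)$ let $\Omega^{+}_{s,n}$ and $\Omega^{-}_{s,n}$ be the sets of all $a\in(0,\infty)^n$ with $\Xi_n(s;a)>0$ and $\Xi_n(s;a)<0$, respectively. **Proposition.** 1. Let $n\ge 10$. If $s\in I_{n,+}$, then $\Xi_n(s;a)>0$ for all $a\in(0,\infty)^n$. If $s\in I_{n,-}$, then $\Omega^{+}_{s,n}$ and $\Omega^{-}_{s,n}$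 are nonempty open sets, and the ray $\{(t,\ldots,t):t>0\}$ is contained in $\Omega^{-}_{s,n}$. 2. Let $1\le n\le 9$ and $s\in(0,n/2)$. Then $\Omega^{-}_{s,n}$ is a nonempty open set that contains the ray $\{(t,\ldots,t):t>0\}$. If moreover $n\ge 2$, then $\Omega^{+}_{s,n}$ is a nonempty open set. -/

import Mathlib

open scoped ComplexOrder

namespace EpsteinXi

/-- `Z` is the meromorphic continuation to `ℂ` of the Epstein zeta series
`∑_{k ∈ ℤⁿ \ {0}} (∑ᵢ (aᵢ kᵢ)²)^(-s)`, `Re s > n/2`: it is meromorphic on `ℂ`, holomorphic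
outside `n/2`, and it is the sum of the (unconditionally convergent) series for `Re s > n/2`. -/
def IsEpsteinContinuation (n : ℕ) (a : Fin n → ℝ) (Z : ℂ → ℂ) : Prop :=
  DifferentiableOn ℂ Z {(n / 2 : ℂ)}ᶜ ∧
  MeromorphicAt Z (n / 2 : ℂ) ∧
  ∀ s : ℂ, (n / 2 : ℝ) < s.re →
    HasSum (fun k : {k : Fin n → ℤ // k ≠ 0} =>
      (((∑ i, (a i * (k.1 i : ℝ)) ^ 2 : ℝ) : ℂ)) ^ (-s)) (Z s)

/-- The continuation is unique away from `n/2`. -/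
theorem IsEpsteinContinuation.eqOn {n : ℕ} {a : Fin n → ℝ} {Z W : ℂ → ℂ}
    (hZ : IsEpsteinContinuation n a Z) (hW : IsEpsteinContinuation n a W) :
    Set.EqOn Z W {(n / 2 : ℂ)}ᶜ := by
  have ho : IsOpen ({(n / 2 : ℂ)}ᶜ : Set ℂ) := isOpen_compl_singleton
  have hc : IsPreconnected ({(n / 2 : ℂ)}ᶜ : Set ℂ) :=
    (isConnected_compl_singleton_of_one_lt_rank (by simp) _).isPreconnected
  have hre : ((n / 2 : ℂ)).re = (n / 2 : ℝ) := by
    have : (n / 2 : ℂ) = ((n / 2 : ℝ) : ℂ) := by push_cast; rfl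
    rw [this, Complex.ofReal_re]
  have hmem : ((n / 2 : ℂ) + 1) ∈ ({(n / 2 : ℂ)}ᶜ : Set ℂ) := by simp
  refine (hZ.1.analyticOnNhd ho).eqOn_of_preconnected_of_eventuallyEq
    (hW.1.analyticOnNhd ho) hc hmem ?_
  have hU : IsOpen {s : ℂ | (n / 2 : ℝ) < s.re} := isOpen_lt continuous_const Complex.continuous_re
  filter_upwards [hU.mem_nhds (show (n / 2 : ℝ) < ((n / 2 : ℂ) + 1).re by
    rw [Complex.add_re, hre]; simp)] with s hs
  exact (hZ.2.2 s hs).unique (hW.2.2 s hs)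

open Classical in
/-- The Epstein zeta function `Z_n(s; a₁, …, aₙ)`, as a meromorphic function of `s ∈ ℂ`. -/
noncomputable def epsteinZeta (n : ℕ) (a : Fin n → ℝ) : ℂ → ℂ :=
  if h : ∃ Z : ℂ → ℂ, IsEpsteinContinuation n a Z then h.choose else 0

/-- `Ξ_n(s; a₁, …, aₙ) = √(∏ᵢ aᵢ) π^(-s) Γ(s) Z_n(s; a₁, …, aₙ)`. -/
noncomputable def Xi (n : ℕ) (s : ℂ) (a : Fin n → ℝ) : ℂ :=
  (Real.sqrt (∏ i, a i) : ℂ) * (Real.pi : ℂ) ^ (-s) * Complex.Gamma s * epsteinZeta n a s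

/-- `I_{n,+} = {s ∈ (0, n/2) : Ξ_n(s; 1, …, 1) > 0}`.
In `ℂ`, `0 < z` means that `z` is real and positive. -/
def IPlus (n : ℕ) : Set ℝ :=
  {s | s ∈ Set.Ioo (0 : ℝ) (n / 2) ∧ 0 < Xi n (s : ℂ) (fun _ => 1)}

/-- `I_{n,-} = {s ∈ (0, n/2) : Ξ_n(s; 1, …, 1) < 0}`. -/
def IMinus (n : ℕ) : Set ℝ :=
  {s | s ∈ Set.Ioo (0 : ℝ) (n / 2) ∧ Xi n (s : ℂ) (fun _ => 1) < 0}

/-- The region `Ω⁺_{s,n}` of all `a ∈ (0, ∞)ⁿ` where `Ξ_n(s; a)` is positive. -/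
def OmegaPlus (n : ℕ) (s : ℝ) : Set (Fin n → ℝ) :=
  {a | (∀ i, 0 < a i) ∧ 0 < Xi n (s : ℂ) a}

/-- The region `Ω⁻_{s,n}` of all `a ∈ (0, ∞)ⁿ` where `Ξ_n(s; a)` is negative. -/
def OmegaMinus (n : ℕ) (s : ℝ) : Set (Fin n → ℝ) :=
  {a | (∀ i, 0 < a i) ∧ Xi n (s : ℂ) a < 0}

end EpsteinXi

/-!
Write `θ(x) = ∑_{k ∈ ℤ} exp(-π k² x)`, `Φ_a(t) = ∏ᵢ θ(aᵢ² t)`, `P = ∏ᵢ aᵢ` and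
`T_a(s) = ∫₁^∞ (Φ_a(t) - 1) t^(s-1) dt`. Splitting the Mellin transform of `Φ_a - 1` at `t = 1` and
using `θ(1/x) = √x θ(x)` gives the continuation of the Epstein zeta function
(`isEpsteinContinuation`) and, for `0 < s < n/2`, the real formula (`Xi_eq_ofReal`)
`Ξ_n(s; a) = √P (T_a(s) - 1/s) + (1/√P) (T_{1/a}(n/2 - s) - 1/(n/2 - s))`.

* *Openness.* By dominated convergence the right-hand side is continuous in `a`
  (`continuousOn_xiReal`).
* *Rays.* `Ξ_n(s; t a)` is a positive multiple of `Ξ_n(s; a)` (`Xi_smul`), so the ray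
  `(t, …, t)` carries the sign of `Ξ_n(s; 1, …, 1)`.
* *Positivity everywhere.* After rescaling, `P = 1`. The function `log θ(e^u)` is convex
  (`convexOn_log_theta_exp`), so by Jensen's inequality `Φ_a(t) ≥ θ(t)ⁿ` for every `t`, and the
  formula gives `Ξ_n(s; a) ≥ Ξ_n(s; 1, …, 1)` (`xiReal_one_le`). For the convexity one shows that
  `x θ'(x) / θ(x)` is increasing: for `x ≥ 1` it is minus the quotient of the decreasing function
  `-x² θ'(x)` by the increasing function `x θ(x)`, and the functional equation reflects this to
  `x ≤ 1`.
* *Positive values for `n ≥ 2`.* For `a = (ε, 1/ε, 1, …, 1)` with `ε → 0` the integral `T_a(s)`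
  tends to infinity while the polar terms stay fixed (`OmegaPlus_nonempty`).
* *Negativity at the cubic lattice for `n ≤ 9`.* At a fixed ratio `s / n` the case `n = 9` is the
  extremal one (`xiReal_one_neg`). For `n = 9` and `s = 9/4 (1 + r)` the claim is
  `∫₁^∞ (θ⁹ - 1)(t^(s-1) + t^(7/2-s)) dt < (8/9) / (1 - r²)`. The integral is convex in `w = r²`, so
  it is at most `2 ((1 - w) A₀ + w A₁)`, where `A₀ = ∫₁^∞ (θ⁹ - 1) t^(5/4) dt ≈ 0.412` belongs to
  the centre `r = 0` and `A₁ = ½ ∫₁^∞ (θ⁹ - 1)(t^(7/2) + t⁻¹) dt ≈ 0.595` to the ends `r = ±1`.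
  The bounds `A₀ < 4/9` and `A₁ < 8/9` suffice, since
  `(1 - w) (4/9) ((1 - w) + 2 w) = (4/9) (1 - w²) ≤ 4/9` (`tail_add_tail_lt`).
-/

namespace EpsteinXi

open Real Set Filter Topology MeasureTheory

/-! ### The theta function of one variable -/

/-- The theta function `θ(x) = ∑_{k ∈ ℤ} exp(-π x k²)` of a positive real variable `x`; for
`x ≤ 0` the series diverges and the value is `0`. -/
noncomputable def theta (x : ℝ) : ℝ := ∑' k : ℤ, exp (-π * x * (k : ℝ) ^ 2)

/-- The series `-θ'(x) = ∑_{k ∈ ℤ} π k² exp(-π x k²)`. -/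
noncomputable def negDerivTheta (x : ℝ) : ℝ :=
  ∑' k : ℤ, π * (k : ℝ) ^ 2 * exp (-π * x * (k : ℝ) ^ 2)

theorem summable_theta {x : ℝ} (hx : 0 < x) :
    Summable fun k : ℤ => exp (-π * x * (k : ℝ) ^ 2) := by
  refine (summable_pow_mul_jacobiTheta₂_term_bound 0 hx 0).congr fun k => ?_
  simp only [pow_zero, one_mul]
  ring_nf

theorem summable_negDerivTheta {x : ℝ} (hx : 0 < x) :
    Summable fun k : ℤ => π * (k : ℝ) ^ 2 * exp (-π * x * (k : ℝ) ^ 2) := by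
  refine ((summable_pow_mul_jacobiTheta₂_term_bound 0 hx 2).mul_left π).congr fun k => ?_
  simp only [Int.cast_abs, sq_abs, mul_assoc]
  ring_nf

theorem one_le_theta {x : ℝ} (hx : 0 < x) : 1 ≤ theta x := by
  have := (summable_theta hx).le_tsum (0 : ℤ) fun k _ => (exp_pos _).le
  simpa [theta] using this

theorem theta_pos {x : ℝ} (hx : 0 < x) : 0 < theta x := one_pos.trans_le (one_le_theta hx)

theorem theta_inv {x : ℝ} (hx : 0 < x) : theta x⁻¹ = √x * theta x := by
  have h := Real.tsum_exp_neg_mul_int_sq hx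
  have h' : ∑' n : ℤ, exp (-π / x * (n : ℝ) ^ 2) = theta x⁻¹ := by
    simp only [theta, div_eq_mul_inv]
  rw [h'] at h
  have hs : 0 < √x := sqrt_pos.2 hx
  rw [show theta x = _ from h, ← sqrt_eq_rpow]
  field_simp

theorem theta_anti {x y : ℝ} (hx : 0 < x) (hxy : x ≤ y) : theta y ≤ theta x := by
  refine (summable_theta (hx.trans_le hxy)).tsum_le_tsum (fun k => ?_) (summable_theta hx)
  refine exp_le_exp.2 ?_
  nlinarith [mul_nonneg (mul_nonneg pi_pos.le (sub_nonneg.2 hxy)) (sq_nonneg (k : ℝ))]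

theorem theta_sub_one_eq {x : ℝ} (hx : 0 < x) :
    theta x - 1 = 2 * ∑' k : ℕ+, exp (-π * x * (k : ℝ) ^ 2) := by
  rw [theta, tsum_int_eq_zero_add_two_mul_tsum_pnat (fun k => by simp) (summable_theta hx)]
  simp

theorem summable_theta_pnat {x : ℝ} (hx : 0 < x) :
    Summable fun k : ℕ+ => exp (-π * x * (k : ℝ) ^ 2) :=
  ((summable_theta hx).comp_injective
    (i := fun k : ℕ+ => ((k : ℕ) : ℤ)) fun a b h => by simpa using h).congr fun k => by simp

/-- All exponents in `θ - 1` are at least that of the leading term, so `θ - 1` decays at least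
as fast as the leading term. -/
theorem theta_sub_one_le {δ x : ℝ} (hδ : 0 < δ) (hx : δ ≤ x) :
    theta x - 1 ≤ (theta δ - 1) * exp (-π * (x - δ)) := by
  rw [theta_sub_one_eq hδ, theta_sub_one_eq (hδ.trans_le hx), mul_assoc, ← tsum_mul_right]
  refine mul_le_mul_of_nonneg_left ?_ zero_le_two
  refine (summable_theta_pnat (hδ.trans_le hx)).tsum_le_tsum (fun k => ?_)
    ((summable_theta_pnat hδ).mul_right _)
  rw [← exp_add]
  refine exp_le_exp.2 ?_
  have hk : (1 : ℝ) ≤ (k : ℝ) ^ 2 := one_le_pow₀ (mod_cast k.2)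
  nlinarith [mul_nonneg (mul_nonneg pi_pos.le (sub_nonneg.2 hx)) (sub_nonneg.2 hk)]

theorem hasDerivAt_theta {x : ℝ} (hx : 0 < x) : HasDerivAt theta (-negDerivTheta x) x := by
  have hδ : 0 < x / 2 := half_pos hx
  have h := hasDerivAt_tsum_of_isPreconnected (y₀ := x) (y := x) (t := Ioi (x / 2))
    (g := fun (k : ℤ) x => exp (-π * x * (k : ℝ) ^ 2))
    (g' := fun (k : ℤ) x => -(π * (k : ℝ) ^ 2 * exp (-π * x * (k : ℝ) ^ 2)))
    (summable_negDerivTheta hδ) isOpen_Ioi isPreconnected_Ioi (fun k y _ => ?_) (fun k y hy => ?_)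
    (half_lt_self hx) (summable_theta hx) (half_lt_self hx)
  · rwa [tsum_neg] at h
  · have := ((((hasDerivAt_id' y).const_mul (-π)).mul_const ((k : ℝ) ^ 2))).exp
    refine this.congr_deriv ?_
    ring
  · rw [norm_neg, norm_of_nonneg (by positivity)]
    refine mul_le_mul_of_nonneg_left (exp_le_exp.2 ?_) (by positivity)
    nlinarith [mul_nonneg (mul_nonneg pi_pos.le (sub_nonneg.2 (le_of_lt hy))) (sq_nonneg (k : ℝ))]

theorem continuousOn_theta : ContinuousOn theta (Ioi 0) := fun _ hx =>
  (hasDerivAt_theta hx).continuousAt.continuousWithinAt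

theorem exp_neg_pi_le : exp (-π) ≤ 0.0433 := by
  have h1 : exp (-π) ≤ exp (-3.1415) := exp_le_exp.2 (by linarith [pi_gt_d4])
  have h2 : (2.7182 : ℝ) ^ 3 ≤ exp 3 := by
    have := exp_one_gt_d9
    calc (2.7182 : ℝ) ^ 3 ≤ (exp 1) ^ 3 := by gcongr; linarith
      _ = exp 3 := by rw [← exp_nat_mul]; norm_num
  have h3 : (1.1515 : ℝ) ≤ exp 0.1415 := by
    have := quadratic_le_exp_of_nonneg (x := 0.1415) (by norm_num)
    norm_num at this ⊢
    linarith
  have h4 : (23.1 : ℝ) ≤ exp 3.1415 := by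
    have : exp 3.1415 = exp 3 * exp 0.1415 := by rw [← exp_add]; norm_num
    rw [this]
    calc (23.1 : ℝ) ≤ 2.7182 ^ 3 * 1.1515 := by norm_num
      _ ≤ _ := by gcongr
  rw [exp_neg] at h1
  refine exp_neg π ▸ h1.trans ?_
  rw [exp_neg]
  exact (inv_anti₀ (by norm_num) h4).trans (by norm_num)

/-- Numerical bound for `θ(1) = 1.0864…`, from `k² ≥ 3k - 2` for `k ≥ 1` and a geometric series. -/
theorem theta_one_sub_one_le : theta 1 - 1 ≤ 0.0867 := by
  rw [theta_sub_one_eq one_pos, tsum_pnat_eq_tsum_succ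
    (f := fun k : ℕ => exp (-π * 1 * (k : ℝ) ^ 2))]
  set q := exp (-π) with hq
  have hq0 : 0 < q := exp_pos _
  have hq1 : q ≤ 0.0433 := exp_neg_pi_le
  have hq3 : q ^ 3 ≤ 0.0001 := (pow_le_pow_left₀ hq0.le hq1 3).trans (by norm_num)
  have hgeo : HasSum (fun k : ℕ => q * (q ^ 3) ^ k) (q * (1 - q ^ 3)⁻¹) :=
    (hasSum_geometric_of_lt_one (by positivity) (by linarith)).mul_left q
  have hle : ∀ k : ℕ, exp (-π * 1 * ((k + 1 : ℕ) : ℝ) ^ 2) ≤ q * (q ^ 3) ^ k := fun k => by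
    have : exp (-π * 1 * ((k + 1 : ℕ) : ℝ) ^ 2) = q ^ ((k + 1) ^ 2) := by
      rw [hq, ← exp_nat_mul]
      push_cast
      ring_nf
    rw [this, ← pow_mul, ← pow_succ']
    refine pow_le_pow_of_le_one hq0.le (by linarith) ?_
    rcases k with _ | k
    · simp
    · nlinarith
  have hs := Summable.of_nonneg_of_le (fun k => (exp_pos _).le) hle hgeo.summable
  have h := hs.tsum_le_tsum hle hgeo.summable
  rw [hgeo.tsum_eq] at h
  have h2 : q * (1 - q ^ 3)⁻¹ ≤ 0.0433 * (0.9999)⁻¹ := by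
    refine mul_le_mul hq1 (inv_anti₀ (by norm_num) (by linarith)) ?_ (by norm_num)
    exact inv_nonneg.2 (by linarith)
  have h3 : (0.0433 : ℝ) * (0.9999)⁻¹ ≤ 0.04335 := by norm_num
  linarith

/-! ### Logarithmic convexity and the minimality of the cubic lattice -/

theorem negDerivTheta_nonneg (x : ℝ) : 0 ≤ negDerivTheta x :=
  tsum_nonneg fun k => by positivity

/-- The reflection formula for the logarithmic derivative of `θ`, from differentiating
`θ(1/x) = √x θ(x)`. -/
theorem mul_negDerivTheta_div_theta_inv {x : ℝ} (hx : 0 < x) :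
    x⁻¹ * negDerivTheta x⁻¹ / theta x⁻¹ = 1 / 2 - x * negDerivTheta x / theta x := by
  have hxi : 0 < x⁻¹ := inv_pos.2 hx
  have hs : 0 < √x := sqrt_pos.2 hx
  have h1 : HasDerivAt (fun y => theta y⁻¹) (-negDerivTheta x⁻¹ * (-(x ^ 2)⁻¹)) x :=
    (hasDerivAt_theta hxi).comp x (hasDerivAt_inv hx.ne')
  have h2 : HasDerivAt (fun y => √y * theta y)
      (1 / (2 * √x) * theta x + √x * -negDerivTheta x) x :=
    (hasDerivAt_sqrt hx.ne').mul (hasDerivAt_theta hx)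
  have h3 : (fun y => theta y⁻¹) =ᶠ[𝓝 x] fun y => √y * theta y := by
    filter_upwards [lt_mem_nhds hx] with y hy using theta_inv hy
  have h4 := (h1.congr_of_eventuallyEq h3.symm).unique h2
  have h5 : negDerivTheta x⁻¹ = x ^ 2 * (1 / (2 * √x) * theta x + √x * -negDerivTheta x) := by
    rw [← h4]
    field_simp
  have hθ := theta_pos hx
  rw [h5, theta_inv hx]
  obtain ⟨r, hr, rfl⟩ : ∃ r : ℝ, 0 < r ∧ x = r ^ 2 := ⟨√x, hs, (sq_sqrt hx.le).symm⟩
  rw [sqrt_sq hr.le]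
  field_simp
  ring

theorem sq_mul_exp_neg_anti {y z : ℝ} (hy : 2 ≤ y) (hyz : y ≤ z) :
    z ^ 2 * exp (-z) ≤ y ^ 2 * exp (-y) := by
  have h : z ^ 2 ≤ y ^ 2 * exp (z - y) := by
    have h1 : z ≤ y * exp ((z - y) / 2) := by
      have := add_one_le_exp ((z - y) / 2)
      nlinarith [mul_nonneg (sub_nonneg.2 hy) (sub_nonneg.2 hyz)]
    calc z ^ 2 ≤ (y * exp ((z - y) / 2)) ^ 2 := pow_le_pow_left₀ (by linarith) h1 2
      _ = y ^ 2 * exp (z - y) := by rw [mul_pow, ← exp_nat_mul]; ring_nf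
  calc z ^ 2 * exp (-z) ≤ y ^ 2 * exp (z - y) * exp (-z) := by gcongr
    _ = y ^ 2 * exp (-y) := by rw [mul_assoc, ← exp_add]; ring_nf

theorem sq_mul_negDerivTheta_anti {x y : ℝ} (hx : 1 ≤ x) (hxy : x ≤ y) :
    y ^ 2 * negDerivTheta y ≤ x ^ 2 * negDerivTheta x := by
  have hx0 : 0 < x := one_pos.trans_le hx
  rw [negDerivTheta, negDerivTheta, ← tsum_mul_left, ← tsum_mul_left]
  refine ((summable_negDerivTheta (hx0.trans_le hxy)).mul_left _).tsum_le_tsum (fun k => ?_)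
    ((summable_negDerivTheta hx0).mul_left _)
  rcases eq_or_ne k 0 with rfl | hk
  · simp
  have hk1 : (1 : ℝ) ≤ (k : ℝ) ^ 2 := by
    have : (1 : ℤ) ≤ k ^ 2 := by have := sq_pos_of_ne_zero hk; omega
    exact_mod_cast this
  have hc : 2 ≤ π * (k : ℝ) ^ 2 := by nlinarith [pi_gt_three]
  have h := sq_mul_exp_neg_anti (y := π * (k : ℝ) ^ 2 * x) (z := π * (k : ℝ) ^ 2 * y)
    (by nlinarith) (by gcongr)
  have e : ∀ u : ℝ, u ^ 2 * (π * (k : ℝ) ^ 2 * exp (-π * u * (k : ℝ) ^ 2)) =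
      (π * (k : ℝ) ^ 2)⁻¹ * ((π * (k : ℝ) ^ 2 * u) ^ 2 * exp (-(π * (k : ℝ) ^ 2 * u))) := by
    intro u
    have : π * (k : ℝ) ^ 2 ≠ 0 := by linarith
    rw [show -π * u * (k : ℝ) ^ 2 = -(π * (k : ℝ) ^ 2 * u) by ring]
    field_simp
  rw [e, e]
  gcongr

theorem negDerivTheta_le_one {x : ℝ} (hx : 1 ≤ x) : negDerivTheta x ≤ 1 := by
  have h1 := mul_negDerivTheta_div_theta_inv one_pos
  have hθ := theta_one_sub_one_le
  have hθ0 := theta_pos one_pos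
  rw [inv_one, one_mul] at h1
  have h2 : negDerivTheta 1 / theta 1 = 1 / 4 := by linarith
  rw [div_eq_iff hθ0.ne'] at h2
  have h3 := sq_mul_negDerivTheta_anti le_rfl hx
  have h4 : 1 * negDerivTheta x ≤ x ^ 2 * negDerivTheta x :=
    mul_le_mul_of_nonneg_right (one_le_pow₀ hx) (negDerivTheta_nonneg x)
  linarith

theorem mul_theta_mono : MonotoneOn (fun x => x * theta x) (Ici 1) := by
  have hd : ∀ x : ℝ, 1 ≤ x →
      HasDerivAt (fun x => x * theta x) (1 * theta x + x * -negDerivTheta x) x := fun x hx =>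
    (hasDerivAt_id x).mul (hasDerivAt_theta (one_pos.trans_le hx))
  refine monotoneOn_of_deriv_nonneg (convex_Ici 1)
    (fun x hx => (hd x hx).continuousAt.continuousWithinAt)
    (fun x hx => (hd x (interior_subset hx)).differentiableAt.differentiableWithinAt)
    fun x hx => ?_
  have hx1 : 1 ≤ x := interior_subset hx
  rw [(hd x hx1).deriv]
  -- `x θ'(x)` is controlled by `x² θ'(x)`, which is largest at `x = 1`.
  have h1 := sq_mul_negDerivTheta_anti le_rfl hx1
  have h2 := negDerivTheta_le_one le_rfl
  have h3 := one_le_theta (one_pos.trans_le hx1)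
  have h4 : x * negDerivTheta x ≤ x ^ 2 * negDerivTheta x :=
    mul_le_mul_of_nonneg_right (by nlinarith) (negDerivTheta_nonneg x)
  linarith

theorem mul_negDerivTheta_div_theta_anti_of_one_le {x y : ℝ} (hx : 1 ≤ x) (hxy : x ≤ y) :
    y * negDerivTheta y / theta y ≤ x * negDerivTheta x / theta x := by
  have hx0 : 0 < x := one_pos.trans_le hx
  have hy0 : 0 < y := hx0.trans_le hxy
  have e : ∀ u : ℝ, 0 < u → u * negDerivTheta u / theta u =
      (u ^ 2 * negDerivTheta u) / (u * theta u) := fun u hu => by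
    have := theta_pos hu
    field_simp
  rw [e x hx0, e y hy0]
  exact div_le_div₀ (mul_nonneg (sq_nonneg x) (negDerivTheta_nonneg x))
    (sq_mul_negDerivTheta_anti hx hxy) (mul_pos hx0 (theta_pos hx0))
    (mul_theta_mono hx (hx.trans hxy) hxy)

theorem mul_negDerivTheta_div_theta_anti {x y : ℝ} (hx : 0 < x) (hxy : x ≤ y) :
    y * negDerivTheta y / theta y ≤ x * negDerivTheta x / theta x := by
  have low : ∀ {x y : ℝ}, 0 < x → x ≤ y → y ≤ 1 →
      y * negDerivTheta y / theta y ≤ x * negDerivTheta x / theta x := by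
    intro x y hx hxy hy
    have hy0 := hx.trans_le hxy
    have h := mul_negDerivTheta_div_theta_anti_of_one_le ((one_le_inv₀ hy0).2 hy)
      (inv_anti₀ hx hxy)
    rw [mul_negDerivTheta_div_theta_inv hx, mul_negDerivTheta_div_theta_inv hy0] at h
    linarith
  rcases le_total 1 x with h1 | h1
  · exact mul_negDerivTheta_div_theta_anti_of_one_le h1 hxy
  rcases le_total y 1 with h2 | h2
  · exact low hx hxy h2
  · exact (mul_negDerivTheta_div_theta_anti_of_one_le le_rfl h2).trans (low hx h1 le_rfl)

/-- `log θ` is a convex function of `log x`. -/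
theorem convexOn_log_theta_exp : ConvexOn ℝ univ fun u => log (theta (exp u)) := by
  have hd : ∀ u : ℝ, HasDerivAt (fun u => log (theta (exp u)))
      (-(exp u * negDerivTheta (exp u) / theta (exp u))) u := fun u => by
    have h := ((hasDerivAt_theta (exp_pos u)).comp u (Real.hasDerivAt_exp u)).log
      (theta_pos (exp_pos u)).ne'
    refine h.congr_deriv ?_
    simp only [Function.comp_apply]
    ring
  refine Monotone.convexOn_univ_of_deriv (fun u => (hd u).differentiableAt) fun u v huv => ?_
  rw [(hd u).deriv, (hd v).deriv]
  exact neg_le_neg (mul_negDerivTheta_div_theta_anti (exp_pos u) (exp_le_exp.2 huv))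

/-- The theta function `Φ_a(t) = ∏ᵢ θ(aᵢ² t) = ∑_{k ∈ ℤⁿ} exp(-π t ∑ᵢ (aᵢ kᵢ)²)` of the lattice
with orthogonal basis vectors of lengths `aᵢ`. -/
noncomputable def latticeTheta {n : ℕ} (a : Fin n → ℝ) (t : ℝ) : ℝ := ∏ i, theta (a i ^ 2 * t)

/-- Among rectangular lattices of covolume one the cubic lattice has the smallest theta function:
this is Jensen's inequality for the convex function `log θ ∘ exp`. -/
theorem latticeTheta_one_le {n : ℕ} (hn : 0 < n) {a : Fin n → ℝ} (ha : ∀ i, 0 < a i)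
    (hP : ∏ i, a i = 1) {t : ℝ} (ht : 0 < t) :
    latticeTheta (fun _ : Fin n => 1) t ≤ latticeTheta a t := by
  have hn' : (0 : ℝ) < n := Nat.cast_pos.2 hn
  have hlog : ∑ i, log (a i) = 0 := by
    rw [← log_prod fun i _ => (ha i).ne', hP, log_one]
  have h := convexOn_log_theta_exp.map_sum_le (t := Finset.univ) (w := fun _ : Fin n => (n : ℝ)⁻¹)
    (p := fun i => 2 * log (a i) + log t) (fun _ _ => by positivity)
    (by simp [hn'.ne']) fun _ _ => mem_univ _
  have e1 : ∑ i : Fin n, (n : ℝ)⁻¹ • (2 * log (a i) + log t) = log t := by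
    simp only [smul_eq_mul, ← Finset.mul_sum, Finset.sum_add_distrib, hlog]
    simp [hn'.ne']
  have e2 : ∀ i, exp (2 * log (a i) + log t) = a i ^ 2 * t := fun i => by
    rw [exp_add, exp_log ht, mul_comm, ← log_rpow (ha i), exp_log (rpow_pos_of_pos (ha i) _),
      rpow_two, mul_comm]
  have hpos : ∀ i, 0 < theta (a i ^ 2 * t) := fun i => theta_pos (mul_pos (pow_pos (ha i) 2) ht)
  rw [e1] at h
  simp only [e2, exp_log ht, smul_eq_mul, ← Finset.mul_sum] at h
  rw [← log_prod fun i _ => (hpos i).ne', ← div_eq_inv_mul, le_div_iff₀ hn', mul_comm,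
    ← log_pow] at h
  have h' := (log_le_log_iff (pow_pos (theta_pos ht) n) (Finset.prod_pos fun i _ => hpos i)).1 h
  simpa [latticeTheta] using h'

/-! ### The theta function of a rectangular lattice and the Epstein series -/

theorem hasSum_prod_fin {n : ℕ} {f : Fin n → ℤ → ℝ} {s : Fin n → ℝ} (h0 : ∀ i k, 0 ≤ f i k)
    (h : ∀ i, HasSum (f i) (s i)) :
    HasSum (fun k : Fin n → ℤ => ∏ i, f i (k i)) (∏ i, s i) := by
  induction n with
  | zero => simp
  | succ n ih =>
    obtain ⟨g, hg⟩ : ∃ g : (Fin n → ℤ) → ℝ, g = fun k => ∏ i : Fin n, f i.succ (k i) := ⟨_, rfl⟩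
    have h1 : HasSum g (∏ i : Fin n, s i.succ) :=
      hg ▸ ih (fun i k => h0 i.succ k) fun i => h i.succ
    have hg0 : 0 ≤ g := fun k => by
      rw [hg]
      exact Finset.prod_nonneg fun i _ => h0 i.succ (k i)
    have h2 : Summable fun x : ℤ × (Fin n → ℤ) => f 0 x.1 * g x.2 :=
      (h 0).summable.mul_of_nonneg h1.summable (h0 0) hg0
    have h3 := (h 0).mul h1 h2
    rw [Fin.prod_univ_succ, ← (Fin.consEquiv fun _ => ℤ).hasSum_iff]
    refine h3.congr_fun ?_
    rintro ⟨x, y⟩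
    simp [Fin.prod_univ_succ, Fin.consEquiv, hg]

theorem hasSum_latticeTheta {n : ℕ} {a : Fin n → ℝ} (ha : ∀ i, 0 < a i) {t : ℝ} (ht : 0 < t) :
    HasSum (fun k : Fin n → ℤ => exp (-π * (∑ i, (a i * (k i : ℝ)) ^ 2) * t))
      (latticeTheta a t) := by
  have h := hasSum_prod_fin (f := fun i (k : ℤ) => exp (-π * (a i ^ 2 * t) * (k : ℝ) ^ 2))
    (fun i k => (exp_pos _).le)
    fun i => (summable_theta (mul_pos (pow_pos (ha i) 2) ht)).hasSum
  refine h.congr_fun fun k => ?_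
  rw [← exp_sum, Finset.mul_sum, Finset.sum_mul]
  refine congrArg exp (Finset.sum_congr rfl fun i _ => ?_)
  ring

theorem one_le_latticeTheta {n : ℕ} {a : Fin n → ℝ} (ha : ∀ i, 0 < a i) {t : ℝ} (ht : 0 < t) :
    1 ≤ latticeTheta a t :=
  Finset.one_le_prod fun i _ => one_le_theta (mul_pos (pow_pos (ha i) 2) ht)

theorem continuousOn_latticeTheta {n : ℕ} {a : Fin n → ℝ} (ha : ∀ i, 0 < a i) :
    ContinuousOn (latticeTheta a) (Ioi 0) := by
  refine continuousOn_finsetProd _ fun i _ => continuousOn_theta.comp (by fun_prop) ?_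
  exact fun t ht => mul_pos (pow_pos (ha i) 2) ht

theorem latticeTheta_inv {n : ℕ} {a : Fin n → ℝ} (ha : ∀ i, 0 < a i) {t : ℝ} (ht : 0 < t) :
    latticeTheta a t⁻¹ = (∏ i, a i)⁻¹ * t ^ (n / 2 : ℝ) * latticeTheta a⁻¹ t := by
  have h : ∀ i, theta (a i ^ 2 * t⁻¹) = (a i)⁻¹ * √t * theta (a⁻¹ i ^ 2 * t) := fun i => by
    have h1 : a i ^ 2 * t⁻¹ = (a⁻¹ i ^ 2 * t)⁻¹ := by simp [mul_comm]
    rw [h1, theta_inv (x := a⁻¹ i ^ 2 * t) (mul_pos (pow_pos (inv_pos.2 (ha i)) 2) ht),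
      sqrt_mul (sq_nonneg _),
      Pi.inv_apply, sqrt_sq (inv_pos.2 (ha i)).le]
  simp only [latticeTheta, h, Finset.prod_mul_distrib, Finset.prod_const, Finset.card_univ,
    Fintype.card_fin, Finset.prod_inv_distrib]
  rw [sqrt_eq_rpow, ← rpow_mul_natCast ht.le, one_div_mul_eq_div]

theorem one_add_mul_pow_sub_one_le {E M : ℝ} (hE0 : 0 ≤ E) (hE1 : E ≤ 1) (hM : 0 ≤ M) (n : ℕ) :
    (1 + E * M) ^ n - 1 ≤ E * ((1 + M) ^ n - 1) := by
  induction n with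
  | zero => simp
  | succ n ih =>
    have h1 : 0 ≤ (1 + M) ^ n - 1 := sub_nonneg.2 (one_le_pow₀ (by linarith))
    have h3 : 0 ≤ (1 + E * M) ^ n - 1 :=
      sub_nonneg.2 (one_le_pow₀ (by linarith [mul_nonneg hE0 hM]))
    have h2 : E * M ≤ M := mul_le_of_le_one_left hM hE1
    calc (1 + E * M) ^ (n + 1) - 1 = (1 + E * M) * ((1 + E * M) ^ n - 1) + E * M := by ring
      _ ≤ (1 + M) * (E * ((1 + M) ^ n - 1)) + E * M := by gcongr
      _ = _ := by ring

/-- Exponential decay of `Φ_a - 1`, uniform in `a` with components bounded below. -/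
theorem latticeTheta_sub_one_le {n : ℕ} {a : Fin n → ℝ} {δ : ℝ} (hδ : 0 < δ) (ha : ∀ i, δ ≤ a i)
    {t : ℝ} (ht : 1 ≤ t) :
    latticeTheta a t - 1 ≤ (theta (δ ^ 2) ^ n - 1) * exp (-(π * δ ^ 2) * (t - 1)) := by
  have hδ2 : 0 < δ ^ 2 := pow_pos hδ 2
  have ht0 : 0 < t := one_pos.trans_le ht
  set E := exp (-(π * δ ^ 2) * (t - 1)) with hE
  have h1 : ∀ i, theta (a i ^ 2 * t) ≤ 1 + E * (theta (δ ^ 2) - 1) := fun i => by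
    have h2 := theta_sub_one_le hδ2 (x := δ ^ 2 * t) (by nlinarith)
    have h3 : theta (a i ^ 2 * t) ≤ theta (δ ^ 2 * t) := by
      have := ha i
      exact theta_anti (mul_pos hδ2 ht0) (by gcongr)
    rw [show -π * (δ ^ 2 * t - δ ^ 2) = -(π * δ ^ 2) * (t - 1) by ring, ← hE] at h2
    linarith
  have h4 : latticeTheta a t ≤ (1 + E * (theta (δ ^ 2) - 1)) ^ n := by
    refine (Finset.prod_le_prod (fun i _ => ?_) fun i _ => h1 i).trans (by simp)
    exact (theta_pos (mul_pos (pow_pos (hδ.trans_le (ha i)) 2) ht0)).le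
  have hE1 : E ≤ 1 := exp_le_one_iff.2 (by
    nlinarith [mul_nonneg (mul_pos pi_pos hδ2).le (sub_nonneg.2 ht)])
  have h5 := one_add_mul_pow_sub_one_le (exp_pos _).le hE1 (sub_nonneg.2 (one_le_theta hδ2)) n
  rw [add_sub_cancel] at h5
  linarith

theorem integrableOn_exp_mul_rpow {c : ℝ} (hc : 0 < c) (p : ℝ) :
    IntegrableOn (fun t => exp (-c * (t - 1)) * t ^ p) (Ioi 1) := by
  have h := ((integrableOn_rpow_mul_exp_neg_mul_rpow (p := 1) (s := |p|) (b := c)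
    (by linarith [abs_nonneg p]) one_pos hc).mono_set
      (Ioi_subset_Ioi zero_le_one)).const_mul (exp c)
  refine Integrable.mono' h ?_ ?_
  · refine ContinuousOn.aestronglyMeasurable (fun t ht => ?_) measurableSet_Ioi
    have : t ≠ 0 := (one_pos.trans ht).ne'
    exact (ContinuousAt.mul (by fun_prop)
      (continuousAt_rpow_const _ _ (Or.inl this))).continuousWithinAt
  · filter_upwards [ae_restrict_mem measurableSet_Ioi] with t ht
    have ht1 : 1 ≤ t := le_of_lt ht
    have ht0 : 0 < t := one_pos.trans ht
    rw [norm_of_nonneg (by positivity), rpow_one]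
    calc exp (-c * (t - 1)) * t ^ p ≤ exp (-c * (t - 1)) * t ^ |p| := by
          gcongr
          exact le_abs_self p
      _ = exp c * (t ^ |p| * exp (-c * t)) := by
          rw [show -c * (t - 1) = c + -c * t by ring, exp_add]
          ring

theorem exists_pos_le {n : ℕ} {a : Fin n → ℝ} (ha : ∀ i, 0 < a i) : ∃ δ > 0, ∀ i, δ ≤ a i := by
  rcases Nat.eq_zero_or_pos n with rfl | hn
  · exact ⟨1, one_pos, fun i => i.elim0⟩
  · have : Nonempty (Fin n) := ⟨⟨0, hn⟩⟩
    obtain ⟨i, hi⟩ := Finite.exists_min a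
    exact ⟨a i, ha i, hi⟩

theorem integrableOn_latticeTheta_sub_one_mul_rpow {n : ℕ} {a : Fin n → ℝ} (ha : ∀ i, 0 < a i)
    (p : ℝ) : IntegrableOn (fun t => (latticeTheta a t - 1) * t ^ p) (Ioi 1) := by
  obtain ⟨δ, hδ, hδa⟩ := exists_pos_le ha
  have h := (integrableOn_exp_mul_rpow (c := π * δ ^ 2) (by positivity) p).const_mul
    (theta (δ ^ 2) ^ n - 1)
  refine Integrable.mono' h ?_ ?_
  · refine ContinuousOn.aestronglyMeasurable ?_ measurableSet_Ioi
    refine (((continuousOn_latticeTheta ha).mono (Ioi_subset_Ioi zero_le_one)).sub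
      continuousOn_const).mul fun t ht => ?_
    exact (continuousAt_rpow_const _ _ (Or.inl (one_pos.trans ht).ne')).continuousWithinAt
  · filter_upwards [ae_restrict_mem measurableSet_Ioi] with t ht
    have ht1 : 1 ≤ t := le_of_lt ht
    have ht0 : 0 < t := one_pos.trans ht
    rw [norm_of_nonneg (mul_nonneg (sub_nonneg.2 (one_le_latticeTheta ha ht0))
      (rpow_nonneg ht0.le _)), ← mul_assoc]
    exact mul_le_mul_of_nonneg_right (latticeTheta_sub_one_le hδ hδa ht1) (rpow_nonneg ht0.le _)

/-- The convergence of the Epstein zeta series, from that of `∑ ‖k‖^(-r)`, `r > n`, over the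
lattice `ℤⁿ` with the supremum norm. -/
theorem summable_epstein {n : ℕ} {a : Fin n → ℝ} (ha : ∀ i, 0 < a i) {σ : ℝ} (hσ : n / 2 < σ) :
    Summable fun k : {k : Fin n → ℤ // k ≠ 0} => (∑ i, (a i * (k.1 i : ℝ)) ^ 2) ^ (-σ) := by
  obtain ⟨δ, hδ, hδa⟩ := exists_pos_le ha
  have hσ0 : 0 < σ := lt_of_le_of_lt (by positivity) hσ
  let L : Submodule ℤ (Fin n → ℝ) := Submodule.span ℤ (range (Pi.basisFun ℝ (Fin n)))
  have hrank : Module.finrank ℤ L = n := by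
    have := Module.finrank_eq_card_basis ((Pi.basisFun ℝ (Fin n)).restrictScalars ℤ)
    simpa using this
  have hmem : ∀ k : Fin n → ℤ, (fun i => (k i : ℝ)) ∈ L := fun k => by
    refine ((Pi.basisFun ℝ (Fin n)).mem_span_iff_repr_mem ℤ _).2 fun i => ?_
    exact ⟨k i, by simp⟩
  have h1 := ZLattice.summable_norm_rpow L (-(2 * σ)) (by rw [hrank]; linarith)
  have hinj : Function.Injective
      fun k : {k : Fin n → ℤ // k ≠ 0} => (⟨fun i => (k.1 i : ℝ), hmem k.1⟩ : L) := by
    intro k l h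
    refine Subtype.ext (funext fun i => ?_)
    exact Int.cast_injective (congrFun (congrArg Subtype.val h) i)
  have h2 := (h1.comp_injective hinj).mul_left (δ ^ (-(2 * σ)))
  refine Summable.of_nonneg_of_le (fun k => by positivity) (fun k => ?_) h2
  simp only [Function.comp_apply]
  set v : Fin n → ℝ := fun i => (k.1 i : ℝ) with hv
  have hv0 : v ≠ 0 := fun h => k.2 (funext fun i => by
    have := congrFun h i
    simpa [hv] using this)
  have hvn : 0 < ‖v‖ := norm_pos_iff.2 hv0
  have hle : (δ * ‖v‖) ^ 2 ≤ ∑ i, (a i * (k.1 i : ℝ)) ^ 2 := by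
    have hn : Nonempty (Fin n) := by
      by_contra hne
      rw [not_nonempty_iff] at hne
      exact hv0 (Subsingleton.elim _ _)
    obtain ⟨i, hi⟩ : ∃ i, ‖v‖ = ‖v i‖ := by
      obtain ⟨i, hi⟩ := Finite.exists_max fun i => ‖v i‖
      exact ⟨i, le_antisymm ((pi_norm_le_iff_of_nonneg (norm_nonneg _)).2 hi) (norm_le_pi_norm v i)⟩
    have h3 : (δ * ‖v‖) ^ 2 ≤ (a i * (k.1 i : ℝ)) ^ 2 := by
      rw [hi, mul_pow, mul_pow, Real.norm_eq_abs, sq_abs]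
      have := hδa i
      gcongr
    exact h3.trans (Finset.single_le_sum (f := fun i => (a i * (k.1 i : ℝ)) ^ 2)
      (fun i _ => sq_nonneg _) (Finset.mem_univ i))
  calc (∑ i, (a i * (k.1 i : ℝ)) ^ 2) ^ (-σ) ≤ ((δ * ‖v‖) ^ 2) ^ (-σ) :=
        rpow_le_rpow_of_nonpos (by positivity) hle (by linarith)
    _ = δ ^ (-(2 * σ)) * ‖v‖ ^ (-(2 * σ)) := by
        rw [← mul_rpow hδ.le hvn.le, ← rpow_natCast, ← rpow_mul (by positivity)]
        push_cast
        ring_nf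

/-! ### Mellin transforms over `(1, ∞)` and Riemann's splitting -/

/-- The integral `∫₁^∞ (Φ_a(t) - 1) t^(s-1) dt` as a Mellin transform in a complex variable `s`. -/
noncomputable def tailMellin {n : ℕ} (a : Fin n → ℝ) (s : ℂ) : ℂ :=
  mellin ((Ioi 1).indicator fun t => ((latticeTheta a t - 1 : ℝ) : ℂ)) s

/-- The integral `∫₁^∞ (Φ_a(t) - 1) t^(s-1) dt` for real `s`. -/
noncomputable def tail {n : ℕ} (a : Fin n → ℝ) (s : ℝ) : ℝ :=
  ∫ t in Ioi 1, (latticeTheta a t - 1) * t ^ (s - 1)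

theorem tailMellin_ofReal {n : ℕ} (a : Fin n → ℝ) (s : ℝ) :
    tailMellin a (s : ℂ) = (tail a s : ℂ) := by
  rw [tailMellin, mellin, tail, ← integral_complex_ofReal]
  simp_rw [← indicator_smul]
  rw [setIntegral_indicator measurableSet_Ioi, Ioi_inter_Ioi, sup_eq_right.2 zero_le_one]
  refine setIntegral_congr_fun measurableSet_Ioi fun t ht => ?_
  have ht0 : 0 < t := one_pos.trans ht
  simp only [smul_eq_mul]
  push_cast
  rw [Complex.ofReal_cpow ht0.le, mul_comm]
  push_cast
  rfl

theorem tail_isBigO {n : ℕ} {a : Fin n → ℝ} (ha : ∀ i, 0 < a i) : ∃ c > 0,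
    ((Ioi 1).indicator fun t => ((latticeTheta a t - 1 : ℝ) : ℂ)) =O[atTop]
      fun t => exp (-c * t) := by
  obtain ⟨δ, hδ, hδa⟩ := exists_pos_le ha
  refine ⟨π * δ ^ 2, by positivity, Asymptotics.IsBigO.of_bound
    ((theta (δ ^ 2) ^ n - 1) * exp (π * δ ^ 2)) ?_⟩
  filter_upwards [eventually_gt_atTop 1] with t ht
  rw [indicator_of_mem (mem_Ioi.2 ht), Complex.norm_real, norm_of_nonneg
    (sub_nonneg.2 (one_le_latticeTheta ha (one_pos.trans ht))), norm_of_nonneg (exp_pos _).le,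
    mul_assoc, ← exp_add]
  convert latticeTheta_sub_one_le hδ hδa ht.le using 3
  ring

theorem locallyIntegrableOn_tail {n : ℕ} {a : Fin n → ℝ} (ha : ∀ i, 0 < a i) :
    LocallyIntegrableOn ((Ioi 1).indicator fun t => ((latticeTheta a t - 1 : ℝ) : ℂ))
      (Ioi 0) := by
  have h := integrableOn_latticeTheta_sub_one_mul_rpow ha 0
  simp only [rpow_zero, mul_one] at h
  have h' : IntegrableOn (fun t => ((latticeTheta a t - 1 : ℝ) : ℂ)) (Ioi 1) := h.ofReal
  exact ((integrable_indicator_iff measurableSet_Ioi).2 h').integrableOn.locallyIntegrableOn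

theorem tail_isBigO_zero {n : ℕ} (a : Fin n → ℝ) (b : ℝ) :
    ((Ioi 1).indicator fun t => ((latticeTheta a t - 1 : ℝ) : ℂ)) =O[𝓝[>] 0]
      fun t => t ^ (-b) := by
  refine (Asymptotics.isBigO_zero _ _).congr' ?_ EventuallyEq.rfl
  filter_upwards [mem_nhdsWithin_of_mem_nhds (Iio_mem_nhds one_pos)] with t ht
  exact (indicator_of_notMem (not_lt.2 (le_of_lt ht)) _).symm

theorem mellinConvergent_tail {n : ℕ} {a : Fin n → ℝ} (ha : ∀ i, 0 < a i) (s : ℂ) :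
    MellinConvergent ((Ioi 1).indicator fun t => ((latticeTheta a t - 1 : ℝ) : ℂ)) s := by
  obtain ⟨c, hc, h⟩ := tail_isBigO ha
  exact mellinConvergent_of_isBigO_rpow_exp hc (locallyIntegrableOn_tail ha) h
    (tail_isBigO_zero a (s.re - 1)) (by linarith)

theorem differentiable_tailMellin {n : ℕ} {a : Fin n → ℝ} (ha : ∀ i, 0 < a i) :
    Differentiable ℂ (tailMellin a) := fun s => by
  obtain ⟨c, hc, h⟩ := tail_isBigO ha
  exact mellin_differentiableAt_of_isBigO_rpow_exp hc (locallyIntegrableOn_tail ha) h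
    (tail_isBigO_zero a (s.re - 1)) (by linarith)

/-- Riemann's splitting of the Mellin transform of `Φ_a - 1`: the part over `(0, 1)` is transformed
by the functional equation of `Φ_a`. -/
theorem mellin_latticeTheta_sub_one {n : ℕ} {a : Fin n → ℝ} (ha : ∀ i, 0 < a i) {s : ℂ}
    (hs : (n / 2 : ℝ) < s.re) :
    mellin (fun t => ((latticeTheta a t - 1 : ℝ) : ℂ)) s =
      tailMellin a s - 1 / s +
        (∏ i, a i : ℝ)⁻¹ * (tailMellin a⁻¹ (n / 2 - s) - 1 / (n / 2 - s)) := by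
  have hai : ∀ i, 0 < a⁻¹ i := fun i => inv_pos.2 (ha i)
  have hs0 : 0 < s.re := lt_of_le_of_lt (by positivity) hs
  set P : ℂ := ((∏ i, a i : ℝ) : ℂ)
  set F : ℝ → ℂ := (Ioi 1).indicator fun t => ((latticeTheta a t - 1 : ℝ) : ℂ)
  set G : ℝ → ℂ := (Ioi 1).indicator fun t => ((latticeTheta a⁻¹ t - 1 : ℝ) : ℂ)
  -- the part of `Φ_a - 1` over `(0, 1)`, up to elementary terms, as a function of `1 / t`
  set H : ℝ → ℂ := fun t => (t : ℂ) ^ (n / 2 : ℂ) • G t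
  have hF : MellinConvergent F s := mellinConvergent_tail ha s
  have hG : MellinConvergent (fun t => H t⁻¹) s := by
    have h := (MellinConvergent.cpow_smul (a := (n / 2 : ℂ)) (s := -s)).2
      (mellinConvergent_tail hai (-s + n / 2))
    have h2 := (MellinConvergent.comp_rpow (f := H) (s := s) (a := -1) (by norm_num)).2
      (by
        rw [Complex.ofReal_neg, Complex.ofReal_one, div_neg, div_one]
        exact h)
    simpa only [rpow_neg_one] using h2
  have hGm : mellin (fun t => H t⁻¹) s = tailMellin a⁻¹ (n / 2 - s) := by
    rw [mellin_comp_inv, mellin_cpow_smul, tailMellin, neg_add_eq_sub]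
  have hpow := hasMellin_cpow_Ioc (-(n / 2 : ℂ)) (s := s) (by
    have : (-(n / 2 : ℂ)).re = -(n / 2 : ℝ) := by
      rw [show (-(n / 2 : ℂ)) = ((-(n / 2) : ℝ) : ℂ) by push_cast; rfl, Complex.ofReal_re]
    rw [this]
    linarith)
  have hone := hasMellin_one_Ioc hs0
  have h1 := hasMellin_const_smul (hasMellin_add hG hpow.1).1 P⁻¹
  have h2 := hasMellin_sub (hasMellin_add hF h1.1).1 hone.1
  have hcongr : mellin (fun t => ((latticeTheta a t - 1 : ℝ) : ℂ)) s = mellin (fun t =>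
      F t + P⁻¹ • (H t⁻¹ + (Ioc 0 1).indicator (fun t : ℝ => (t : ℂ) ^ (-(n / 2 : ℂ))) t)
        - (Ioc 0 1).indicator (fun _ => 1) t) s := by
    refine setIntegral_congr_ae measurableSet_Ioi ?_
    filter_upwards [(measure_singleton (1 : ℝ) : volume {(1 : ℝ)} = 0) |>
      compl_mem_ae_iff.2] with t ht1 ht0
    congr 1
    have ht0 : 0 < t := ht0
    have ht1 : t ≠ 1 := ht1
    rcases lt_or_gt_of_ne ht1 with h | h
    · have e1 : F t = 0 := indicator_of_notMem (not_lt.2 h.le) _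
      have e2 : G t⁻¹ = ((latticeTheta a⁻¹ t⁻¹ - 1 : ℝ) : ℂ) :=
        indicator_of_mem (mem_Ioi.2 ((one_lt_inv₀ ht0).2 h)) _
      have hmem : t ∈ Ioc (0 : ℝ) 1 := ⟨ht0, h.le⟩
      have e3 := latticeTheta_inv ha (inv_pos.2 ht0)
      rw [inv_inv] at e3
      have e4 : ((t⁻¹ : ℝ) : ℂ) ^ (n / 2 : ℂ) = ((t⁻¹ ^ (n / 2 : ℝ) : ℝ) : ℂ) := by
        rw [Complex.ofReal_cpow (inv_pos.2 ht0).le]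
        push_cast
        rfl
      have e5 : (t : ℂ) ^ (-(n / 2 : ℂ)) = ((t⁻¹ ^ (n / 2 : ℝ) : ℝ) : ℂ) := by
        rw [inv_rpow ht0.le, ← rpow_neg ht0.le, Complex.ofReal_cpow ht0.le]
        push_cast
        rfl
      simp only [H, e1, e2, indicator_of_mem hmem, e4, e5, e3, P, smul_eq_mul]
      push_cast
      ring
    · have e1 : F t = ((latticeTheta a t - 1 : ℝ) : ℂ) := indicator_of_mem (mem_Ioi.2 h) _
      have e2 : G t⁻¹ = 0 :=
        indicator_of_notMem (not_lt.2 (inv_le_one_of_one_le₀ h.le)) _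
      have hmem : t ∉ Ioc (0 : ℝ) 1 := fun h' => not_le.2 h h'.2
      simp [H, e1, e2, indicator_of_notMem hmem]
  rw [hcongr, h2.2, (hasMellin_add hF h1.1).2, h1.2, (hasMellin_add hG hpow.1).2, hpow.2, hone.2,
    hGm, smul_eq_mul, ← sub_eq_add_neg, ← neg_sub ((n : ℂ) / 2) s, one_div_neg_eq_neg_one_div,
    show tailMellin a s = mellin F s from rfl]
  simp only [P, Complex.ofReal_inv]
  ring

/-! ### The continuation of the Epstein zeta function and the formula for `Ξ_n` -/

/-- The continuation of the Epstein zeta function given by Riemann's splitting. The pole of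
`1 / s` at the origin is absorbed into `1 / Γ` by `s Γ(s) = Γ(s + 1)`. -/
noncomputable def epsteinContinuation {n : ℕ} (a : Fin n → ℝ) (s : ℂ) : ℂ :=
  (π : ℂ) ^ s * ((Complex.Gamma s)⁻¹ * (tailMellin a s + (∏ i, a i : ℝ)⁻¹ *
    (tailMellin a⁻¹ (n / 2 - s) - 1 / (n / 2 - s))) - (Complex.Gamma (s + 1))⁻¹)

theorem hasSum_epsteinContinuation {n : ℕ} {a : Fin n → ℝ} (ha : ∀ i, 0 < a i) {s : ℂ}
    (hs : (n / 2 : ℝ) < s.re) :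
    HasSum (fun k : {k : Fin n → ℤ // k ≠ 0} =>
      (((∑ i, (a i * (k.1 i : ℝ)) ^ 2 : ℝ) : ℂ)) ^ (-s)) (epsteinContinuation a s) := by
  have hs0 : 0 < s.re := lt_of_le_of_lt (by positivity) hs
  have hs' : s ≠ 0 := fun h => by simp [h] at hs0
  have hΓ : Complex.Gamma s ≠ 0 := Complex.Gamma_ne_zero_of_re_pos hs0
  have hpi : (π : ℂ) ^ s ≠ 0 := by simp [Complex.cpow_eq_zero_iff, pi_ne_zero]
  have hq : ∀ k : {k : Fin n → ℤ // k ≠ 0}, 0 < ∑ i, (a i * (k.1 i : ℝ)) ^ 2 := fun k => by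
    obtain ⟨i, hi⟩ := Function.ne_iff.1 k.2
    refine Finset.sum_pos' (fun i _ => sq_nonneg _) ⟨i, Finset.mem_univ i, ?_⟩
    have h1 : (k.1 i : ℝ) ≠ 0 := Int.cast_ne_zero.2 hi
    have h2 := (ha i).ne'
    positivity
  have h := hasSum_mellin_pi_mul (ι := {k : Fin n → ℤ // k ≠ 0}) (a := fun _ => 1)
    (q := fun k => ∑ i, (a i * (k.1 i : ℝ)) ^ 2)
    (F := fun t => ((latticeTheta a t - 1 : ℝ) : ℂ)) (s := s) (fun k => Or.inr (hq k)) hs0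
    (fun t ht => ?_) ?_
  · have h1 := h.mul_left ((π : ℂ) ^ s * (Complex.Gamma s)⁻¹)
    rw [mellin_latticeTheta_sub_one ha hs] at h1
    have e1 : (π : ℂ) ^ s * (Complex.Gamma s)⁻¹ * (tailMellin a s - 1 / s + (∏ i, a i : ℝ)⁻¹ *
        (tailMellin a⁻¹ (n / 2 - s) - 1 / (n / 2 - s))) = epsteinContinuation a s := by
      rw [epsteinContinuation, Complex.Gamma_add_one s hs', mul_inv]
      ring
    rw [e1] at h1
    refine h1.congr_fun fun k => ?_
    have hk : ((∑ i, (a i * (k.1 i : ℝ)) ^ 2 : ℝ) : ℂ) ^ s ≠ 0 := by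
      simp [Complex.cpow_eq_zero_iff, -Complex.ofReal_sum, (hq k).ne']
    rw [Complex.cpow_neg, Complex.cpow_neg]
    field_simp
  · have h1 := hasSum_latticeTheta ha ht
    have h2 : HasSum ((fun k : Fin n → ℤ => exp (-π * (∑ i, (a i * (k i : ℝ)) ^ 2) * t)) ∘
        ((↑) : ({0} : Set (Fin n → ℤ)) → (Fin n → ℤ))) 1 := by
      have h5 := hasSum_fintype ((fun k : Fin n → ℤ =>
        exp (-π * (∑ i, (a i * (k i : ℝ)) ^ 2) * t)) ∘
        ((↑) : ({0} : Set (Fin n → ℤ)) → (Fin n → ℤ)))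
      simpa using h5
    have h3 := h2.hasSum_compl_iff (a₂ := latticeTheta a t - 1) |>.2 (by simpa using h1)
    have h4 := Complex.hasSum_ofReal.2 h3
    simp only [one_mul]
    exact h4
  · refine (summable_epstein ha hs).congr fun k => ?_
    rw [rpow_neg (hq k).le]
    simp

theorem isEpsteinContinuation {n : ℕ} {a : Fin n → ℝ} (ha : ∀ i, 0 < a i) :
    IsEpsteinContinuation n a (epsteinContinuation a) := by
  have hT := differentiable_tailMellin ha
  have hT' := differentiable_tailMellin (a := a⁻¹) fun i => inv_pos.2 (ha i)
  have hΓ := Complex.differentiable_one_div_Gamma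
  have hpi : Differentiable ℂ fun s : ℂ => (π : ℂ) ^ s := fun s =>
    differentiableAt_id.const_cpow (Or.inl (mod_cast pi_ne_zero))
  set P : ℂ := ((∏ i, a i : ℝ) : ℂ) with hP
  -- the polar part is split off: both `A` and `B` are entire
  set A : ℂ → ℂ := fun s => (π : ℂ) ^ s * ((Complex.Gamma s)⁻¹ * (tailMellin a s +
    P⁻¹ * tailMellin a⁻¹ (n / 2 - s)) - (Complex.Gamma (s + 1))⁻¹) with hA
  set B : ℂ → ℂ := fun s => -((π : ℂ) ^ s * (Complex.Gamma s)⁻¹ * P⁻¹) with hB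
  have hAd : Differentiable ℂ A :=
    hpi.mul ((hΓ.mul (hT.add ((hT'.comp (by fun_prop : Differentiable ℂ fun s : ℂ =>
      (n : ℂ) / 2 - s)).const_mul _))).sub (hΓ.comp (by fun_prop : Differentiable ℂ fun s : ℂ =>
      s + 1)))
  have hBd : Differentiable ℂ B := ((hpi.mul hΓ).mul_const _).neg
  have hZ : epsteinContinuation a = fun s => A s + B s * ((n : ℂ) / 2 - s)⁻¹ := by
    funext s
    simp only [epsteinContinuation, hA, hB, hP]
    push_cast
    ring
  refine ⟨?_, ?_, fun s hs => hasSum_epsteinContinuation ha hs⟩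
  · rw [hZ]
    refine hAd.differentiableOn.add (hBd.differentiableOn.mul
      (DifferentiableOn.inv (by fun_prop) fun s hs => ?_))
    exact sub_ne_zero.2 (Ne.symm hs)
  · rw [hZ]
    have h1 : Differentiable ℂ fun s : ℂ => (n : ℂ) / 2 - s := by fun_prop
    exact (hAd.analyticAt _).meromorphicAt.add
      ((hBd.analyticAt _).meromorphicAt.mul (h1.analyticAt _).meromorphicAt.inv)

theorem isEpsteinContinuation_epsteinZeta {n : ℕ} {a : Fin n → ℝ} (ha : ∀ i, 0 < a i) :
    IsEpsteinContinuation n a (epsteinZeta n a) := by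
  have h : ∃ Z : ℂ → ℂ, IsEpsteinContinuation n a Z := ⟨_, isEpsteinContinuation ha⟩
  rw [epsteinZeta, dif_pos h]
  exact h.choose_spec

/-- The value `Ξ_n(s; a)` for real `s`, written with the convergent integrals of Riemann's
splitting. -/
noncomputable def xiReal {n : ℕ} (s : ℝ) (a : Fin n → ℝ) : ℝ :=
  √(∏ i, a i) * (tail a s - 1 / s) +
    (√(∏ i, a i))⁻¹ * (tail a⁻¹ (n / 2 - s) - 1 / (n / 2 - s))

theorem ofReal_ne_half {n : ℕ} {s : ℝ} (hs : s ∈ Ioo (0 : ℝ) (n / 2)) :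
    (s : ℂ) ∈ ({(n / 2 : ℂ)}ᶜ : Set ℂ) := fun h => by
  have h1 : (s : ℂ) = ((n / 2 : ℝ) : ℂ) := by
    push_cast
    exact h
  exact hs.2.ne (Complex.ofReal_injective h1)

theorem Xi_eq_ofReal {n : ℕ} {s : ℝ} (hs : s ∈ Ioo (0 : ℝ) (n / 2)) {a : Fin n → ℝ}
    (ha : ∀ i, 0 < a i) : Xi n (s : ℂ) a = (xiReal s a : ℂ) := by
  have hP : 0 < ∏ i, a i := Finset.prod_pos fun i _ => ha i
  have hs' : (s : ℂ) ≠ 0 := Complex.ofReal_ne_zero.2 hs.1.ne'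
  have hΓ : Complex.Gamma s ≠ 0 := Complex.Gamma_ne_zero_of_re_pos (by simpa using hs.1)
  have hpi : (π : ℂ) ^ (s : ℂ) ≠ 0 := by simp [Complex.cpow_eq_zero_iff, pi_ne_zero]
  have e : epsteinZeta n a s = epsteinContinuation a s :=
    (isEpsteinContinuation_epsteinZeta ha).eqOn (isEpsteinContinuation ha) (ofReal_ne_half hs)
  have e2 : ((n : ℂ) / 2 - (s : ℂ)) = ((n / 2 - s : ℝ) : ℂ) := by push_cast; rfl
  rw [Xi, e, epsteinContinuation, xiReal, Complex.Gamma_add_one _ hs', e2, tailMellin_ofReal,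
    tailMellin_ofReal, Complex.cpow_neg]
  obtain ⟨r, hr, hrP⟩ : ∃ r : ℝ, 0 < r ∧ ∏ i, a i = r ^ 2 :=
    ⟨√(∏ i, a i), sqrt_pos.2 hP, (sq_sqrt hP.le).symm⟩
  have hrc : (r : ℂ) ≠ 0 := Complex.ofReal_ne_zero.2 hr.ne'
  rw [hrP, sqrt_sq hr.le]
  generalize hu : tail a s = u
  generalize hv : tail a⁻¹ (n / 2 - s) = v
  generalize hw : (n / 2 - s : ℝ) = w
  have hwc : (w : ℂ) ≠ 0 := Complex.ofReal_ne_zero.2 (by linarith [hs.2])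
  push_cast
  field_simp
  ring

/-- Homogeneity of `Ξ_n` in the scale of `a`. -/
theorem Xi_smul {n : ℕ} {s : ℝ} (hs : s ∈ Ioo (0 : ℝ) (n / 2)) {a : Fin n → ℝ}
    (ha : ∀ i, 0 < a i) {t : ℝ} (ht : 0 < t) :
    ∃ c : ℝ, 0 < c ∧ Xi n (s : ℂ) (t • a) = c * Xi n (s : ℂ) a := by
  have hta : ∀ i, 0 < (t • a) i := fun i => mul_pos ht (ha i)
  have htc : (t : ℂ) ≠ 0 := Complex.ofReal_ne_zero.2 ht.ne'
  have h := isEpsteinContinuation_epsteinZeta ha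
  have hd : Differentiable ℂ fun z : ℂ => ((t ^ 2 : ℝ) : ℂ) ^ (-z) := fun z =>
    differentiableAt_id.neg.const_cpow (Or.inl (mod_cast (pow_pos ht 2).ne'))
  have h1 : IsEpsteinContinuation n (t • a) fun z => ((t ^ 2 : ℝ) : ℂ) ^ (-z) *
      epsteinZeta n a z := by
    refine ⟨hd.differentiableOn.mul h.1, (hd.analyticAt _).meromorphicAt.mul h.2.1,
      fun z hz => ((h.2.2 z hz).mul_left _).congr_fun fun k => ?_⟩
    rw [← Complex.mul_cpow_ofReal_nonneg (by positivity)
      (Finset.sum_nonneg fun i _ => sq_nonneg _), ← Complex.ofReal_mul, Finset.mul_sum]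
    refine congrArg (fun x : ℝ => (x : ℂ) ^ (-z)) (Finset.sum_congr rfl fun i _ => ?_)
    simp only [Pi.smul_apply, smul_eq_mul]
    ring
  have e := (isEpsteinContinuation_epsteinZeta hta).eqOn h1 (ofReal_ne_half hs)
  refine ⟨√(t ^ n) * (t ^ 2) ^ (-s), by positivity, ?_⟩
  have e2 : ∏ i, (t • a) i = t ^ n * ∏ i, a i := by
    simp [Finset.prod_mul_distrib]
  rw [Xi, Xi, e, e2, sqrt_mul (by positivity)]
  push_cast
  rw [Complex.ofReal_cpow (by positivity)]
  push_cast
  ring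

/-! ### Dependence of `Ξ_n(s; a)` on `a` -/

theorem isOpen_pos (n : ℕ) : IsOpen {a : Fin n → ℝ | ∀ i, 0 < a i} := by
  simp only [ofPred_forall]
  exact isOpen_iInter_of_finite fun i => isOpen_lt continuous_const (continuous_apply i)

theorem continuousOn_tail {n : ℕ} (s : ℝ) :
    ContinuousOn (fun a : Fin n → ℝ => tail a s) {a | ∀ i, 0 < a i} := by
  intro a ha
  refine ContinuousAt.continuousWithinAt ?_
  obtain ⟨δ, hδ, hδa⟩ := exists_pos_le ha
  have hδ2 : 0 < δ / 2 := half_pos hδ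
  have hnear : ∀ᶠ b in 𝓝 a, ∀ i, δ / 2 ≤ b i := by
    refine eventually_all.2 fun i => ?_
    filter_upwards [(continuous_apply i).continuousAt.eventually
      (lt_mem_nhds (show δ / 2 < a i by linarith [hδa i]))] with b hb using le_of_lt hb
  refine continuousAt_of_dominated (bound := fun t => (theta ((δ / 2) ^ 2) ^ n - 1) *
    (exp (-(π * (δ / 2) ^ 2) * (t - 1)) * t ^ (s - 1))) ?_ ?_ ?_ ?_
  · filter_upwards [hnear] with b hb
    exact (integrableOn_latticeTheta_sub_one_mul_rpow (fun i => hδ2.trans_le (hb i))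
      (s - 1)).aestronglyMeasurable
  · filter_upwards [hnear] with b hb
    filter_upwards [ae_restrict_mem measurableSet_Ioi] with t ht
    have ht0 : 0 < t := one_pos.trans ht
    rw [norm_of_nonneg (mul_nonneg (sub_nonneg.2 (one_le_latticeTheta
      (fun i => hδ2.trans_le (hb i)) ht0)) (rpow_nonneg ht0.le _)), ← mul_assoc]
    exact mul_le_mul_of_nonneg_right (latticeTheta_sub_one_le hδ2 hb (le_of_lt ht))
      (rpow_nonneg ht0.le _)
  · exact (integrableOn_exp_mul_rpow (by positivity) _).const_mul _
  · filter_upwards [ae_restrict_mem measurableSet_Ioi] with t ht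
    have ht0 : 0 < t := one_pos.trans ht
    refine ContinuousAt.mul (ContinuousAt.sub ?_ continuousAt_const) continuousAt_const
    refine tendsto_finsetProd _ fun i _ => ?_
    have h1 : ContinuousAt theta (a i ^ 2 * t) :=
      (hasDerivAt_theta (mul_pos (pow_pos (ha i) 2) ht0)).continuousAt
    exact ContinuousAt.comp (f := fun b : Fin n → ℝ => b i ^ 2 * t) h1
      (((continuous_apply i).pow 2).mul continuous_const).continuousAt

theorem continuousOn_xiReal {n : ℕ} (s : ℝ) :
    ContinuousOn (fun a : Fin n → ℝ => xiReal s a) {a | ∀ i, 0 < a i} := by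
  have hP : ContinuousOn (fun a : Fin n → ℝ => √(∏ i, a i)) {a | ∀ i, 0 < a i} := by
    fun_prop
  have hinv : ContinuousOn (fun a : Fin n → ℝ => a⁻¹) {a | ∀ i, 0 < a i} :=
    continuousOn_pi.2 fun i => (continuous_apply i).continuousOn.inv₀ fun a ha => (ha i).ne'
  refine (hP.mul ((continuousOn_tail s).sub continuousOn_const)).add
    ((hP.inv₀ fun a ha => ?_).mul ((((continuousOn_tail (n / 2 - s)).comp hinv ?_)).sub
      continuousOn_const))
  · exact (sqrt_pos.2 (Finset.prod_pos fun i _ => ha i)).ne'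
  · exact fun a ha i => inv_pos.2 (ha i)

theorem mem_OmegaPlus_iff {n : ℕ} {s : ℝ} (hs : s ∈ Ioo (0 : ℝ) (n / 2)) {a : Fin n → ℝ} :
    a ∈ OmegaPlus n s ↔ (∀ i, 0 < a i) ∧ 0 < xiReal s a := by
  refine and_congr_right fun ha => ?_
  rw [Xi_eq_ofReal hs ha, Complex.zero_lt_real]

theorem mem_OmegaMinus_iff {n : ℕ} {s : ℝ} (hs : s ∈ Ioo (0 : ℝ) (n / 2)) {a : Fin n → ℝ} :
    a ∈ OmegaMinus n s ↔ (∀ i, 0 < a i) ∧ xiReal s a < 0 := by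
  refine and_congr_right fun ha => ?_
  rw [Xi_eq_ofReal hs ha, ← Complex.ofReal_zero, Complex.real_lt_real]

theorem isOpen_OmegaPlus {n : ℕ} {s : ℝ} (hs : s ∈ Ioo (0 : ℝ) (n / 2)) :
    IsOpen (OmegaPlus n s) := by
  have h := (continuousOn_xiReal (n := n) s).isOpen_inter_preimage (isOpen_pos n) isOpen_Ioi
    (t := Ioi 0)
  convert h using 1
  ext a
  exact mem_OmegaPlus_iff hs

theorem isOpen_OmegaMinus {n : ℕ} {s : ℝ} (hs : s ∈ Ioo (0 : ℝ) (n / 2)) :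
    IsOpen (OmegaMinus n s) := by
  have h := (continuousOn_xiReal (n := n) s).isOpen_inter_preimage (isOpen_pos n) isOpen_Iio
    (t := Iio 0)
  convert h using 1
  ext a
  exact mem_OmegaMinus_iff hs

theorem tail_nonneg {n : ℕ} {a : Fin n → ℝ} (ha : ∀ i, 0 < a i) (s : ℝ) : 0 ≤ tail a s :=
  setIntegral_nonneg measurableSet_Ioi fun t ht => by
    have ht0 : 0 < t := one_pos.trans ht
    exact mul_nonneg (sub_nonneg.2 (one_le_latticeTheta ha ht0)) (rpow_nonneg ht0.le _)

theorem tail_mono {m n : ℕ} {a : Fin m → ℝ} {b : Fin n → ℝ} (ha : ∀ i, 0 < a i)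
    (hb : ∀ i, 0 < b i) (hab : ∀ t, 1 < t → latticeTheta a t ≤ latticeTheta b t) {s s' : ℝ}
    (hs : s ≤ s') : tail a s ≤ tail b s' := by
  refine setIntegral_mono_on (integrableOn_latticeTheta_sub_one_mul_rpow ha _)
    (integrableOn_latticeTheta_sub_one_mul_rpow hb _) measurableSet_Ioi fun t ht => ?_
  have ht0 : 0 < t := one_pos.trans ht
  refine mul_le_mul (sub_le_sub_right (hab t ht) 1)
    (rpow_le_rpow_of_exponent_le (le_of_lt ht) (by linarith)) (rpow_nonneg ht0.le _)
    (sub_nonneg.2 (one_le_latticeTheta hb ht0))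

/-- Among rectangular lattices of covolume one, `Ξ_n(s; ·)` is smallest at the cubic lattice. -/
theorem xiReal_one_le {n : ℕ} (hn : 0 < n) {a : Fin n → ℝ} (ha : ∀ i, 0 < a i)
    (hP : ∏ i, a i = 1) (s : ℝ) : xiReal s (fun _ : Fin n => 1) ≤ xiReal s a := by
  have hai : ∀ i, 0 < a⁻¹ i := fun i => inv_pos.2 (ha i)
  have hPi : ∏ i, a⁻¹ i = 1 := by simp [Finset.prod_inv_distrib, hP]
  have h1 : ((fun _ : Fin n => (1 : ℝ))⁻¹) = fun _ => 1 := by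
    funext i
    simp
  have h2 := tail_mono (fun _ => one_pos) ha
    (fun t ht => latticeTheta_one_le hn ha hP (one_pos.trans ht)) (le_refl s)
  have h3 := tail_mono (fun _ => one_pos) hai
    (fun t ht => latticeTheta_one_le hn hai hPi (one_pos.trans ht)) (le_refl (n / 2 - s))
  simp only [xiReal, hP, h1, Finset.prod_const_one, sqrt_one, inv_one, one_mul]
  linarith

/-- A degenerate lattice makes `Ξ_n(s; ·)` positive: with `a = (ε, ε⁻¹, 1, …, 1)` the integrand
`Φ_a(t) - 1` is at least `θ(ε² t) - 1 ≥ θ(2 ε²) - 1` on `(1, 2)`, which is unbounded as `ε → 0`. -/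
theorem OmegaPlus_nonempty {n : ℕ} (hn : 2 ≤ n) {s : ℝ} (hs : s ∈ Ioo (0 : ℝ) (n / 2)) :
    (OmegaPlus n s).Nonempty := by
  obtain ⟨m, rfl⟩ : ∃ m, n = m + 2 := ⟨n - 2, by omega⟩
  have hs2 : 0 < (m + 2 : ℕ) / 2 - s := by linarith [hs.2]
  set C := 1 / s + 1 / ((m + 2 : ℕ) / 2 - s) with hC
  have hC0 : 0 < C := add_pos (one_div_pos.2 hs.1) (one_div_pos.2 hs2)
  set c := ∫ t in Ioo (1 : ℝ) 2, t ^ (s - 1) with hc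
  have hint : IntegrableOn (fun t : ℝ => t ^ (s - 1)) (Ioo 1 2) := by
    refine (ContinuousOn.integrableOn_Icc fun t ht => ?_).mono_set Ioo_subset_Icc_self
    exact (continuousAt_rpow_const _ _ (Or.inl (one_pos.trans_le ht.1).ne')).continuousWithinAt
  have hc0 : 0 < c := by
    refine (setIntegral_pos_iff_support_of_nonneg_ae ?_ hint).2 ?_
    · filter_upwards [ae_restrict_mem measurableSet_Ioo] with t ht
      exact rpow_nonneg (one_pos.trans ht.1).le _
    · have h : Ioo (1 : ℝ) 2 ⊆ (Function.support fun t : ℝ => t ^ (s - 1)) ∩ Ioo 1 2 :=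
        fun t ht => ⟨(rpow_pos_of_pos (one_pos.trans ht.1) _).ne', ht⟩
      refine lt_of_lt_of_le ?_ (measure_mono h)
      simp
  -- chosen so that `θ(2 ε²) - 1 ≥ (2 ε²)^(-1/2) - 1 = C / c + 1`
  set x := (C / c + 2)⁻¹ with hx
  have hx0 : 0 < x := by positivity
  set ε := √(x ^ 2 / 2) with hε
  have hε0 : 0 < ε := sqrt_pos.2 (by positivity)
  have hε2 : ε ^ 2 * 2 = x ^ 2 := by
    rw [hε, sq_sqrt (by positivity)]
    ring
  have hθ : C / c + 2 ≤ theta (ε ^ 2 * 2) := by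
    have h := theta_inv (x := (x ^ 2)⁻¹) (by positivity)
    rw [inv_inv, sqrt_inv, sqrt_sq hx0.le, hx, inv_inv] at h
    rw [hε2, hx, h]
    exact le_mul_of_one_le_right (by positivity) (one_le_theta (by positivity))
  set a : Fin (m + 2) → ℝ := Fin.cons ε (Fin.cons ε⁻¹ fun _ => 1) with ha_def
  have ha : ∀ i, 0 < a i := by
    intro i
    refine Fin.cases ?_ (fun i => Fin.cases ?_ (fun i => ?_) i) i
    · simpa [ha_def] using hε0
    · simpa [ha_def] using hε0
    · simp [ha_def]
  have hP : ∏ i, a i = 1 := by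
    simp [ha_def, Fin.prod_univ_succ, hε0.ne']
  have hΦ : ∀ t ∈ Ioo (1 : ℝ) 2, C / c + 1 ≤ latticeTheta a t - 1 := fun t ht => by
    have ht0 : 0 < t := one_pos.trans ht.1
    have h1 : theta (ε ^ 2 * t) ≤ latticeTheta a t := by
      rw [latticeTheta, Fin.prod_univ_succ]
      refine le_mul_of_one_le_right (theta_pos (by positivity)).le
        (Finset.one_le_prod fun i _ => one_le_theta (mul_pos (pow_pos (ha _) 2) ht0))
    have h2 : theta (ε ^ 2 * 2) ≤ theta (ε ^ 2 * t) :=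
      theta_anti (by positivity) (mul_le_mul_of_nonneg_left ht.2.le (by positivity))
    linarith
  have htail : (C / c + 1) * c ≤ tail a s := by
    have hI := integrableOn_latticeTheta_sub_one_mul_rpow ha (s - 1)
    calc (C / c + 1) * c = ∫ t in Ioo (1 : ℝ) 2, (C / c + 1) * t ^ (s - 1) := by
          rw [integral_const_mul]
      _ ≤ ∫ t in Ioo (1 : ℝ) 2, (latticeTheta a t - 1) * t ^ (s - 1) :=
          setIntegral_mono_on (hint.const_mul _) (hI.mono_set Ioo_subset_Ioi_self)
            measurableSet_Ioo fun t ht =>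
              mul_le_mul_of_nonneg_right (hΦ t ht) (rpow_nonneg (one_pos.trans ht.1).le _)
      _ ≤ tail a s := by
          refine setIntegral_mono_set hI ?_ (Ioo_subset_Ioi_self).eventuallyLE
          filter_upwards [ae_restrict_mem measurableSet_Ioi] with t ht
          have ht0 : 0 < t := one_pos.trans ht
          exact mul_nonneg (sub_nonneg.2 (one_le_latticeTheta ha ht0)) (rpow_nonneg ht0.le _)
  have hCc : (C / c + 1) * c = C + c := by
    field_simp
  have htail' := tail_nonneg (a := a⁻¹) (fun i => inv_pos.2 (ha i)) ((m + 2 : ℕ) / 2 - s)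
  refine ⟨a, (mem_OmegaPlus_iff hs).2 ⟨ha, ?_⟩⟩
  rw [xiReal, hP, sqrt_one, inv_one, one_mul, one_mul]
  linarith

/-- Positivity at the cubic lattice propagates to every `a`: rescale to covolume one. -/
theorem Xi_pos_of_mem_IPlus {n : ℕ} (hn : 0 < n) {s : ℝ} (hs : s ∈ IPlus n) {a : Fin n → ℝ}
    (ha : ∀ i, 0 < a i) : 0 < Xi n (s : ℂ) a := by
  have hP : 0 < ∏ i, a i := Finset.prod_pos fun i _ => ha i
  set t := (∏ i, a i) ^ ((n : ℝ)⁻¹) with ht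
  have ht0 : 0 < t := rpow_pos_of_pos hP _
  have htn : t ^ n = ∏ i, a i := rpow_inv_natCast_pow hP.le hn.ne'
  have hb : ∀ i, 0 < (t⁻¹ • a) i := fun i => mul_pos (inv_pos.2 ht0) (ha i)
  have hbP : ∏ i, (t⁻¹ • a) i = 1 := by
    simp [Finset.prod_mul_distrib, htn, hP.ne']
  obtain ⟨c, hc, h⟩ := Xi_smul hs.1 hb ht0
  have h1 := hs.2
  rw [Xi_eq_ofReal hs.1 fun _ => one_pos, Complex.zero_lt_real] at h1
  rw [smul_inv_smul₀ ht0.ne', Xi_eq_ofReal hs.1 hb, ← Complex.ofReal_mul] at h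
  rw [h, Complex.zero_lt_real]
  exact mul_pos hc (h1.trans_le (xiReal_one_le hn hb hbP s))

theorem const_mem_OmegaMinus {n : ℕ} {s : ℝ} (hs : s ∈ IMinus n) {t : ℝ} (ht : 0 < t) :
    (fun _ : Fin n => t) ∈ OmegaMinus n s := by
  obtain ⟨c, hc, h⟩ := Xi_smul (a := fun _ : Fin n => 1) hs.1 (fun _ => one_pos) ht
  have h1 := hs.2
  have e : t • (fun _ : Fin n => (1 : ℝ)) = fun _ => t := by
    funext i
    simp
  rw [Xi_eq_ofReal hs.1 fun _ => one_pos, ← Complex.ofReal_zero, Complex.real_lt_real] at h1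
  rw [e, Xi_eq_ofReal hs.1 fun _ => one_pos, ← Complex.ofReal_mul] at h
  refine ⟨fun _ => ht, ?_⟩
  rw [h, ← Complex.ofReal_zero, Complex.real_lt_real]
  exact mul_neg_of_pos_of_neg hc h1

/-! ### Negativity at the cubic lattice in dimension at most nine -/

/-- A chord bound for `cosh`: as a function of `r²`, `cosh (r x)` is a power series with nonnegative
coefficients, hence convex. -/
theorem cosh_mul_le {r : ℝ} (hr : r ^ 2 ≤ 1) (x : ℝ) :
    cosh (r * x) ≤ 1 - r ^ 2 + r ^ 2 * cosh x := by
  have h1 := hasSum_cosh (r * x)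
  have h2 := ((hasSum_cosh x).mul_left (r ^ 2)).add (hasSum_ite_eq 0 (1 - r ^ 2))
  have h3 := hasSum_le (fun n => ?_) h1 h2
  · linarith
  · rcases n with _ | n
    · simp
    · have h4 : r ^ (2 * (n + 1)) ≤ r ^ 2 := by
        rw [pow_mul]
        exact pow_le_of_le_one (sq_nonneg r) hr n.succ_ne_zero
      have h5 : 0 ≤ x ^ (2 * (n + 1)) := by
        rw [pow_mul]
        positivity
      simp only [Nat.add_eq_zero_iff, one_ne_zero, and_false, if_false, add_zero, mul_pow,
        ← mul_div_assoc]
      gcongr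

theorem rpow_five_quarters_le {t : ℝ} (ht : 1 ≤ t) : t ^ (5 / 4 : ℝ) ≤ (3 * t + t ^ 2) / 4 := by
  have ht0 : 0 < t := one_pos.trans_le ht
  have h1 : t ^ (1 / 4 : ℝ) ≤ 1 + 1 / 4 * (t - 1) := by
    have h := rpow_one_add_le_one_add_mul_self (s := t - 1) (by linarith) (p := 1 / 4)
      (by norm_num) (by norm_num)
    rwa [add_sub_cancel] at h
  have h2 : t ^ (5 / 4 : ℝ) = t * t ^ (1 / 4 : ℝ) := by
    rw [show (5 / 4 : ℝ) = 1 + 1 / 4 by norm_num, rpow_add ht0, rpow_one]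
  rw [h2]
  nlinarith

/-- The kernel `t^(s-1) + t^(7/2-s)` at `s = 9/4 (1 + r)` lies below the chord in `r²` between the
centre `r = 0` and the ends `r = ±1` of the critical interval. -/
theorem rpow_add_rpow_le {r t : ℝ} (hr : r ^ 2 ≤ 1) (ht : 1 ≤ t) :
    t ^ (9 / 4 * (1 + r) - 1) + t ^ (9 / 4 * (1 - r) - 1) ≤
      2 * ((1 - r ^ 2) * ((3 * t + t ^ 2) / 4) + r ^ 2 * ((t ^ 4 + 1) / 2)) := by
  have ht0 : 0 < t := one_pos.trans_le ht
  have hcosh : ∀ y : ℝ, t ^ y + t ^ (-y) = 2 * cosh (y * log t) := fun y => by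
    rw [cosh_eq, rpow_def_of_pos ht0, rpow_def_of_pos ht0]
    ring_nf
  have e1 : t ^ (9 / 4 * (1 + r) - 1) + t ^ (9 / 4 * (1 - r) - 1) =
      t ^ (5 / 4 : ℝ) * (2 * cosh (r * (9 / 4 * log t))) := by
    rw [show r * (9 / 4 * log t) = 9 / 4 * r * log t by ring, ← hcosh, mul_add (t ^ (5 / 4 : ℝ)),
      ← rpow_add ht0, ← rpow_add ht0]
    ring_nf
  have e2 : t ^ (5 / 4 : ℝ) * (2 * cosh (9 / 4 * log t)) = t ^ (7 / 2 : ℝ) + t ^ (-1 : ℝ) := by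
    rw [← hcosh, mul_add, ← rpow_add ht0, ← rpow_add ht0]
    norm_num
  have h1 := cosh_mul_le hr (9 / 4 * log t)
  have h2 : t ^ (7 / 2 : ℝ) ≤ t ^ 4 := by
    rw [← rpow_natCast]
    exact rpow_le_rpow_of_exponent_le ht (by norm_num)
  have h3 : t ^ (-1 : ℝ) ≤ 1 := rpow_le_one_of_one_le_of_nonpos ht (by norm_num)
  have h4 := rpow_five_quarters_le ht
  have h5 : 0 < t ^ (5 / 4 : ℝ) := rpow_pos_of_pos ht0 _
  calc t ^ (9 / 4 * (1 + r) - 1) + t ^ (9 / 4 * (1 - r) - 1)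
      = t ^ (5 / 4 : ℝ) * (2 * cosh (r * (9 / 4 * log t))) := e1
    _ ≤ t ^ (5 / 4 : ℝ) * (2 * (1 - r ^ 2 + r ^ 2 * cosh (9 / 4 * log t))) := by gcongr
    _ = 2 * ((1 - r ^ 2) * t ^ (5 / 4 : ℝ)) +
          r ^ 2 * (t ^ (5 / 4 : ℝ) * (2 * cosh (9 / 4 * log t))) := by ring
    _ = 2 * ((1 - r ^ 2) * t ^ (5 / 4 : ℝ) + r ^ 2 * ((t ^ (7 / 2 : ℝ) + t ^ (-1 : ℝ)) / 2)) := by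
        rw [e2]
        ring
    _ ≤ _ := by
        have : 0 ≤ 1 - r ^ 2 := sub_nonneg.2 hr
        gcongr

/-- The exponential moment `∫₁^∞ exp(-b (t - 1)) t^k dt`. -/
noncomputable def expMoment (b : ℝ) (k : ℕ) : ℝ := ∫ t in Ioi 1, exp (-b * (t - 1)) * t ^ k

theorem integrableOn_exp_mul_pow {b : ℝ} (hb : 0 < b) (k : ℕ) :
    IntegrableOn (fun t => exp (-b * (t - 1)) * t ^ k) (Ioi 1) := by
  simpa only [rpow_natCast] using integrableOn_exp_mul_rpow hb k

theorem tendsto_exp_mul_pow {b : ℝ} (hb : 0 < b) (k : ℕ) :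
    Tendsto (fun t => exp (-b * (t - 1)) * t ^ k) atTop (𝓝 0) := by
  have h := (tendsto_rpow_mul_exp_neg_mul_atTop_nhds_zero k b hb).const_mul (exp b)
  rw [mul_zero] at h
  refine h.congr fun t => ?_
  rw [rpow_natCast, show -b * (t - 1) = b + -b * t by ring, exp_add]
  ring

theorem hasDerivAt_exp_neg_mul (b t : ℝ) :
    HasDerivAt (fun t => exp (-b * (t - 1))) (-b * exp (-b * (t - 1))) t := by
  refine (((hasDerivAt_id' t).sub_const 1).const_mul (-b)).exp.congr_deriv ?_
  ring

theorem expMoment_zero {b : ℝ} (hb : 0 < b) : expMoment b 0 = 1 / b := by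
  have hI := (integrableOn_exp_mul_pow hb 0).const_mul (-b)
  have hlim := tendsto_exp_mul_pow hb 0
  simp only [pow_zero, mul_one] at hI hlim
  have h := integral_Ioi_of_hasDerivAt_of_tendsto' (a := 1)
    (fun t _ => hasDerivAt_exp_neg_mul b t) hI hlim
  rw [integral_const_mul] at h
  simp only [expMoment, pow_zero, mul_one]
  rw [sub_self, mul_zero, exp_zero] at h
  rw [eq_div_iff hb.ne']
  linarith

theorem expMoment_succ {b : ℝ} (hb : 0 < b) (k : ℕ) :
    expMoment b (k + 1) = (1 + (k + 1) * expMoment b k) / b := by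
  have hI := (integrableOn_exp_mul_pow hb (k + 1)).const_mul (-b)
  have hI' := (integrableOn_exp_mul_pow hb k).const_mul ((k : ℝ) + 1)
  have h := integral_Ioi_of_hasDerivAt_of_tendsto' (a := 1)
    (f := fun t => exp (-b * (t - 1)) * t ^ (k + 1))
    (f' := fun t => -b * (exp (-b * (t - 1)) * t ^ (k + 1)) +
      ((k : ℝ) + 1) * (exp (-b * (t - 1)) * t ^ k))
    (fun t _ => ((hasDerivAt_exp_neg_mul b t).mul (hasDerivAt_pow (k + 1) t)).congr_deriv
      (by rw [Nat.add_sub_cancel]; push_cast; ring))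
    (hI.add hI') (tendsto_exp_mul_pow hb (k + 1))
  rw [integral_add hI hI', integral_const_mul, integral_const_mul, sub_self, mul_zero, exp_zero,
    one_pow, one_mul] at h
  rw [eq_div_iff hb.ne']
  simp only [expMoment]
  linarith

theorem integrableOn_exp_mul_quartic {b : ℝ} (hb : 0 < b) (c₀ c₁ c₂ c₄ : ℝ) :
    IntegrableOn (fun t => exp (-b * (t - 1)) * (c₀ + c₁ * t + c₂ * t ^ 2 + c₄ * t ^ 4))
      (Ioi 1) ∧
    ∫ t in Ioi 1, exp (-b * (t - 1)) * (c₀ + c₁ * t + c₂ * t ^ 2 + c₄ * t ^ 4) =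
      c₀ * expMoment b 0 + c₁ * expMoment b 1 + c₂ * expMoment b 2 + c₄ * expMoment b 4 := by
  have h0 := (integrableOn_exp_mul_pow hb 0).const_mul c₀
  have h1 := (integrableOn_exp_mul_pow hb 1).const_mul c₁
  have h2 := (integrableOn_exp_mul_pow hb 2).const_mul c₂
  have h4 := (integrableOn_exp_mul_pow hb 4).const_mul c₄
  have e : (fun t => exp (-b * (t - 1)) * (c₀ + c₁ * t + c₂ * t ^ 2 + c₄ * t ^ 4)) = fun t =>
      c₀ * (exp (-b * (t - 1)) * t ^ 0) + c₁ * (exp (-b * (t - 1)) * t ^ 1) +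
      c₂ * (exp (-b * (t - 1)) * t ^ 2) + c₄ * (exp (-b * (t - 1)) * t ^ 4) := by
    funext t
    ring
  rw [e]
  refine ⟨((h0.add h1).add h2).add h4, ?_⟩
  simp only [expMoment, ← integral_const_mul]
  rw [← integral_add h0 h1, ← integral_add _ h2, ← integral_add _ h4]
  · exact (h0.add h1).add h2
  · exact h0.add h1

/-- The first two terms of the expansion of `θ⁹ - 1` in powers of `exp(-π t)`, with constants
enlarged to absorb the remaining ones and `π` replaced by `3.14` in the exponents. -/
theorem theta_pow_nine_sub_one_le {t : ℝ} (ht : 1 ≤ t) :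
    theta t ^ 9 - 1 ≤ 0.7803 * exp (-3.14 * (t - 1)) + 0.3346 * exp (-6.28 * (t - 1)) := by
  set e := exp (-3.14 * (t - 1)) with he
  have he0 : 0 < e := exp_pos _
  have he1 : e ≤ 1 := exp_le_one_iff.2 (by linarith)
  have he2 : exp (-6.28 * (t - 1)) = e ^ 2 := by
    rw [he, ← exp_nat_mul]
    congr 1
    push_cast
    ring
  have h1 : exp (-π * (t - 1)) ≤ e := exp_le_exp.2 (by nlinarith [pi_gt_d2])
  have hθ : theta t ≤ 1 + 0.0867 * e := by
    have h := theta_sub_one_le one_pos ht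
    have h2 : (theta 1 - 1) * exp (-π * (t - 1)) ≤ 0.0867 * e :=
      mul_le_mul theta_one_sub_one_le h1 (exp_pos _).le (by norm_num)
    linarith
  have h9 : theta t ^ 9 ≤ (1 + 0.0867 * e) ^ 9 :=
    pow_le_pow_left₀ (theta_pos (one_pos.trans_le ht)).le hθ 9
  set z := 0.0867 * e with hz
  have hz0 : 0 ≤ z := by positivity
  have hz1 : z ≤ 0.0867 := by linarith
  have hpoly : 36 + 84 * z + 126 * z ^ 2 + 126 * z ^ 3 + 84 * z ^ 4 + 36 * z ^ 5 + 9 * z ^ 6 +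
      z ^ 7 ≤ 44.5 := by
    calc _ ≤ 36 + 84 * (0.0867 : ℝ) + 126 * 0.0867 ^ 2 + 126 * 0.0867 ^ 3 + 84 * 0.0867 ^ 4 +
          36 * 0.0867 ^ 5 + 9 * 0.0867 ^ 6 + 0.0867 ^ 7 := by gcongr
      _ ≤ 44.5 := by norm_num
  have hexp : (1 + z) ^ 9 - 1 = 9 * z + z ^ 2 * (36 + 84 * z + 126 * z ^ 2 + 126 * z ^ 3 +
      84 * z ^ 4 + 36 * z ^ 5 + 9 * z ^ 6 + z ^ 7) := by ring
  have h3 := mul_le_mul_of_nonneg_left hpoly (sq_nonneg z)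
  have hz2 : z ^ 2 = 0.00751689 * e ^ 2 := by
    rw [hz]
    ring
  rw [he2]
  nlinarith [sq_nonneg e]

/-- In dimension nine the integrals in Riemann's splitting are dominated by the polar terms on the
whole critical interval. -/
theorem tail_add_tail_lt {r : ℝ} (hr : r ^ 2 < 1) :
    tail (fun _ : Fin 9 => 1) (9 / 4 * (1 + r)) + tail (fun _ : Fin 9 => 1) (9 / 4 * (1 - r)) <
      8 / 9 / (1 - r ^ 2) := by
  have hw : 0 < 1 - r ^ 2 := sub_pos.2 hr
  have hone : ∀ i : Fin 9, (0 : ℝ) < (fun _ => 1) i := fun _ => one_pos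
  have hI₁ := integrableOn_latticeTheta_sub_one_mul_rpow hone (9 / 4 * (1 + r) - 1)
  have hI₂ := integrableOn_latticeTheta_sub_one_mul_rpow hone (9 / 4 * (1 - r) - 1)
  set w := r ^ 2 with hw_def
  have hw0 : 0 ≤ w := sq_nonneg r
  obtain ⟨hX, hXe⟩ := integrableOn_exp_mul_quartic (b := 3.14) (by norm_num)
    w ((1 - w) * (3 / 2)) ((1 - w) / 2) w
  obtain ⟨hY, hYe⟩ := integrableOn_exp_mul_quartic (b := 6.28) (by norm_num)
    w ((1 - w) * (3 / 2)) ((1 - w) / 2) w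
  have hle : tail (fun _ : Fin 9 => 1) (9 / 4 * (1 + r)) +
      tail (fun _ : Fin 9 => 1) (9 / 4 * (1 - r)) ≤
      0.7803 * (∫ t in Ioi 1, exp (-3.14 * (t - 1)) *
        (w + (1 - w) * (3 / 2) * t + (1 - w) / 2 * t ^ 2 + w * t ^ 4)) +
      0.3346 * (∫ t in Ioi 1, exp (-6.28 * (t - 1)) *
        (w + (1 - w) * (3 / 2) * t + (1 - w) / 2 * t ^ 2 + w * t ^ 4)) := by
    rw [tail, tail, ← integral_add hI₁ hI₂, ← integral_const_mul, ← integral_const_mul,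
      ← integral_add (hX.const_mul _) (hY.const_mul _)]
    refine setIntegral_mono_on (hI₁.add hI₂) ((hX.const_mul _).add (hY.const_mul _))
      measurableSet_Ioi fun t ht => ?_
    have ht1 : 1 ≤ t := le_of_lt ht
    have ht0 : 0 < t := one_pos.trans ht
    have h1 := rpow_add_rpow_le (r := r) hr.le ht1
    have h2 := theta_pow_nine_sub_one_le ht1
    have h3 : latticeTheta (fun _ : Fin 9 => 1) t = theta t ^ 9 := by simp [latticeTheta]
    have h4 : 0 ≤ latticeTheta (fun _ : Fin 9 => 1) t - 1 :=
      sub_nonneg.2 (one_le_latticeTheta hone ht0)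
    rw [← mul_add]
    rw [← h3] at h2
    refine (mul_le_mul h2 h1 (by positivity) (h4.trans h2)).trans_eq ?_
    ring
  rw [hXe, hYe] at hle
  refine hle.trans_lt ?_
  rw [lt_div_iff₀ hw]
  simp only [expMoment_succ (show (0 : ℝ) < 3.14 by norm_num),
    expMoment_succ (show (0 : ℝ) < 6.28 by norm_num),
    expMoment_zero (show (0 : ℝ) < 3.14 by norm_num),
    expMoment_zero (show (0 : ℝ) < 6.28 by norm_num)]
  -- the left side is at most `2 (1 - w) ((1 - w) A + w B)` with `A < 4/9` and `B < 8/9`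
  norm_num
  nlinarith [mul_nonneg hw0 hw.le, mul_nonneg hw.le hw.le]

/-- On the cubic lattice in dimension at most nine `Ξ_n` is negative on the critical interval: at a
fixed ratio `s / n` the integrals increase with `n` and the polar terms decrease in absolute
value, so dimension nine is extremal. -/
theorem xiReal_one_neg {n : ℕ} (hn : 1 ≤ n) (hn9 : n ≤ 9) {s : ℝ} (hs : s ∈ Ioo (0 : ℝ) (n / 2)) :
    xiReal s (fun _ : Fin n => 1) < 0 := by
  have hn0 : (0 : ℝ) < n := by exact_mod_cast hn
  have hn9' : (n : ℝ) ≤ 9 := by exact_mod_cast hn9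
  obtain ⟨r, hr⟩ : ∃ r : ℝ, s = n / 4 * (1 + r) := ⟨4 * s / n - 1, by field_simp; ring⟩
  have hr1 : 0 < 1 + r := by
    have := hs.1
    rw [hr] at this
    exact pos_of_mul_pos_right this (by positivity)
  have hr2 : 0 < 1 - r := by
    have h : 0 < (n : ℝ) / 4 * (1 - r) := by linarith [hs.2]
    exact pos_of_mul_pos_right h (by positivity)
  have hr3 : r ^ 2 < 1 := by nlinarith
  have hs' : (n : ℝ) / 2 - s = n / 4 * (1 - r) := by
    rw [hr]
    ring
  have hone : ∀ (m : ℕ) (i : Fin m), (0 : ℝ) < (fun _ : Fin m => (1 : ℝ)) i := fun _ _ => one_pos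
  have hΦ : ∀ t, 1 < t →
      latticeTheta (fun _ : Fin n => 1) t ≤ latticeTheta (fun _ : Fin 9 => 1) t := fun t ht => by
    simp only [latticeTheta, one_pow, one_mul, Finset.prod_const, Finset.card_univ,
      Fintype.card_fin]
    exact pow_le_pow_right₀ (one_le_theta (one_pos.trans ht)) hn9
  have h1 := tail_mono (hone n) (hone 9) hΦ (s := n / 4 * (1 + r)) (s' := 9 / 4 * (1 + r))
    (by gcongr)
  have h2 := tail_mono (hone n) (hone 9) hΦ (s := n / 4 * (1 - r)) (s' := 9 / 4 * (1 - r))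
    (by gcongr)
  have h3 := tail_add_tail_lt hr3
  have h4 : 1 / ((n : ℝ) / 4 * (1 + r)) + 1 / (n / 4 * (1 - r)) = 8 / n / (1 - r ^ 2) := by
    rw [show 1 - r ^ 2 = (1 + r) * (1 - r) by ring]
    field_simp
    ring
  have h5 : (8 : ℝ) / 9 / (1 - r ^ 2) ≤ 8 / n / (1 - r ^ 2) := by
    have : 0 < 1 - r ^ 2 := by linarith
    gcongr
  have e : ((fun _ : Fin n => (1 : ℝ))⁻¹) = fun _ => 1 := by
    funext i
    simp
  rw [xiReal, e, hs', hr]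
  simp only [Finset.prod_const_one, sqrt_one, inv_one, one_mul]
  linarith

end EpsteinXi

theorem mainTheorem9 :
    -- `n ≥ 10`, `s ∈ I_{n,+}`
    (∀ n : ℕ, 10 ≤ n → ∀ s ∈ EpsteinXi.IPlus n,
      ∀ a : Fin n → ℝ, (∀ i, 0 < a i) → 0 < EpsteinXi.Xi n (s : ℂ) a) ∧
    -- `n ≥ 10`, `s ∈ I_{n,-}`
    (∀ n : ℕ, 10 ≤ n → ∀ s ∈ EpsteinXi.IMinus n,
      (IsOpen (EpsteinXi.OmegaPlus n s) ∧ (EpsteinXi.OmegaPlus n s).Nonempty) ∧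
      (IsOpen (EpsteinXi.OmegaMinus n s) ∧ (EpsteinXi.OmegaMinus n s).Nonempty) ∧
      ∀ t : ℝ, 0 < t → (fun _ : Fin n => t) ∈ EpsteinXi.OmegaMinus n s) ∧
    -- `1 ≤ n ≤ 9`, every `s ∈ (0, n/2)`
    (∀ n : ℕ, 1 ≤ n → n ≤ 9 → ∀ s ∈ Set.Ioo (0 : ℝ) (n / 2),
      (2 ≤ n → IsOpen (EpsteinXi.OmegaPlus n s) ∧ (EpsteinXi.OmegaPlus n s).Nonempty) ∧
      (IsOpen (EpsteinXi.OmegaMinus n s) ∧ (EpsteinXi.OmegaMinus n s).Nonempty) ∧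
      ∀ t : ℝ, 0 < t → (fun _ : Fin n => t) ∈ EpsteinXi.OmegaMinus n s) := by
  open EpsteinXi in
  refine ⟨fun n hn s hs a ha => Xi_pos_of_mem_IPlus (by omega) hs ha, fun n hn s hs => ?_,
    fun n hn hn9 s hs => ?_⟩
  · exact ⟨⟨isOpen_OmegaPlus hs.1, OmegaPlus_nonempty (by omega) hs.1⟩,
      ⟨isOpen_OmegaMinus hs.1, ⟨_, const_mem_OmegaMinus hs one_pos⟩⟩,
      fun t ht => const_mem_OmegaMinus hs ht⟩
  · have h : s ∈ IMinus n := by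
      refine ⟨hs, ?_⟩
      rw [Xi_eq_ofReal hs fun _ => one_pos, ← Complex.ofReal_zero, Complex.real_lt_real]
      exact xiReal_one_neg hn hn9 hs
    exact ⟨fun h2 => ⟨isOpen_OmegaPlus hs, OmegaPlus_nonempty h2 hs⟩,
      ⟨isOpen_OmegaMinus hs, ⟨_, const_mem_OmegaMinus h one_pos⟩⟩,
      fun t ht => const_mem_OmegaMinus h ht⟩
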